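/- Let $n\ge 2$, and let $\Sigma_n$ be the convex polygon with $2n+4$ vertices, labelled in cyclic order $B, v_1,\dots,v_n, A, C, u_n,\dots,u_1, D$. Let $\mathcal T^+_n$ be the triangulation of $\Sigma_n$ with the diagonals $BC$, $Bu_i$ and $Cv_j$ $(1\le i,j\le n)$, and let $\mathcal T^-_n$ be the triangulation of $\Sigma_n$ with the diagonals $AD$, $Au_i$ and $Dv_j$ $(1\le i,j\le n)$. Let $\tau_n$ be the triangulation of the sphere obtained by placing $\mathcal T^+_n$ on top of $\mathcal T^-_n$ and gluing the two along the boundary of $\Sigma_n$; its triangles are those of $\mathcal T^+_n$ together with those of $\mathcal T^-_n$. A tetrahedral decomposition extending $\tau_n$ is a topological triangulation of the closed $3$-ball with boundary $\tau_n$, that is, a finite collection of tetrahedra, each with four distinct vertices, glued along faces so that the resulting space is homeomorphic to the closed $3$-ball and the triangles lying in only one tetrahedron are exactly the triangles of $\tau_n$. (Two simplices with the same vertices need not coincide, and vertices in the interior of the ball are allowed.) Let $\mathrm{tet}(\tau_n)$ be the smallest number of tetrahedra in such a decomposition. Then $$\mathrm{tet}(\tau_n)=2n+3 .$$ -/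

import Mathlib

/-! ### Triangulations of a convex polygon

The vertices of a convex `N`-gon are `0, 1, …, N - 1` in cyclic order.  A segment between two
vertices is written as the pair `(a, b)` of its endpoints with `a < b`. -/

/-- `(a, b)`, with `a < b`, is a side of the convex `N`-gon. -/
def IsPolygonSide {N : ℕ} (d : Fin N × Fin N) : Prop :=
  d.1 < d.2 ∧ ((d.1 : ℕ) + 1 = d.2 ∨ ((d.1 : ℕ) = 0 ∧ (d.2 : ℕ) + 1 = N))

/-- `(a, b)`, with `a < b`, is a diagonal of the convex `N`-gon. -/
def IsPolygonDiagonal {N : ℕ} (d : Fin N × Fin N) : Prop :=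
  d.1 < d.2 ∧ ¬ IsPolygonSide d

/-- Two segments between vertices of the polygon cross in their interiors: their endpoints
alternate in the cyclic order. -/
def SegmentsCross {N : ℕ} (d e : Fin N × Fin N) : Prop :=
  (d.1 < e.1 ∧ e.1 < d.2 ∧ d.2 < e.2) ∨ (e.1 < d.1 ∧ d.1 < e.2 ∧ e.2 < d.2)

/-- A triangulation of the convex `N`-gon: a maximal set of pairwise non-crossing diagonals. -/
structure PolygonTriangulation (N : ℕ) where
  diagonals : Set (Fin N × Fin N)
  isDiagonal : ∀ d ∈ diagonals, IsPolygonDiagonal d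
  noncrossing : ∀ d ∈ diagonals, ∀ e ∈ diagonals, ¬ SegmentsCross d e
  maximal : ∀ d, IsPolygonDiagonal d → (∀ e ∈ diagonals, ¬ SegmentsCross d e) → d ∈ diagonals

/-- The triangles of a triangulation of the polygon: the triples of vertices that are pairwise
joined by a side of the polygon or by a diagonal of the triangulation. -/
def PolygonTriangulation.triangles {N : ℕ} (T : PolygonTriangulation N) :
    Set (Finset (Fin N)) :=
  {s | s.card = 3 ∧ ∀ a ∈ s, ∀ b ∈ s, a < b → IsPolygonSide (a, b) ∨ (a, b) ∈ T.diagonals}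

/-- The triangles of the triangulation of the sphere obtained by placing `T` on top of `T'` and
gluing the two along the boundary of the polygon (for `T`, `T'` without a common diagonal). -/
def sphereTriangulation {N : ℕ} (T T' : PolygonTriangulation N) : Set (Finset (Fin N)) :=
  T.triangles ∪ T'.triangles

/-! ### The polygon with `2 n + 4` vertices and its two triangulations

The cyclic order of the vertices is `B, v₁, …, vₙ, A, C, uₙ, …, u₁, D`. -/

namespace SigmaPolygon

def B (n : ℕ) : Fin (2 * n + 4) := ⟨0, by omega⟩

/-- The vertices `v₁, …, vₙ`; the index of `v n j` starts at `0`, so `v n j` is `v_{j+1}`. -/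
def v (n : ℕ) (j : Fin n) : Fin (2 * n + 4) := ⟨j + 1, by omega⟩

def A (n : ℕ) : Fin (2 * n + 4) := ⟨n + 1, by omega⟩

def C (n : ℕ) : Fin (2 * n + 4) := ⟨n + 2, by omega⟩

/-- The vertices `u₁, …, uₙ`; the index of `u n i` starts at `0`, so `u n i` is `u_{i+1}`. -/
def u (n : ℕ) (i : Fin n) : Fin (2 * n + 4) := ⟨2 * n + 2 - i, by omega⟩

def D (n : ℕ) : Fin (2 * n + 4) := ⟨2 * n + 3, by omega⟩

/-- The triangulation with diagonals `BC`, `B uᵢ` and `C vⱼ`. -/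
def Tplus (n : ℕ) : PolygonTriangulation (2 * n + 4) where
  diagonals := {d | d = (B n, C n) ∨ (∃ i, d = (B n, u n i)) ∨ (∃ j, d = (v n j, C n))}
  isDiagonal := by
    rintro d (rfl | ⟨i, rfl⟩ | ⟨i, rfl⟩) <;>
      simp only [IsPolygonDiagonal, IsPolygonSide, B, C, u, v, Fin.lt_def] <;> omega
  noncrossing := by
    rintro d (rfl | ⟨i, rfl⟩ | ⟨i, rfl⟩) e (rfl | ⟨j, rfl⟩ | ⟨j, rfl⟩) <;>
      simp only [SegmentsCross, B, C, u, v, Fin.lt_def] <;> omega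
  maximal := by
    rintro ⟨⟨a, ha⟩, ⟨b, hb⟩⟩ hd hc
    simp only [IsPolygonDiagonal, IsPolygonSide, Fin.lt_def] at hd
    have h0 := hc (B n, C n) (Or.inl rfl)
    have h1 : ∀ i : Fin n, _ := fun i => hc (B n, u n i) (Or.inr (Or.inl ⟨i, rfl⟩))
    have h2 : ∀ j : Fin n, _ := fun j => hc (v n j, C n) (Or.inr (Or.inr ⟨j, rfl⟩))
    simp only [SegmentsCross, B, C, u, v, Fin.lt_def] at h0 h1 h2
    simp only [Set.mem_ofPred_eq, B, C, u, v, Prod.mk.injEq, Fin.mk.injEq]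
    rcases Nat.eq_zero_or_pos a with rfl | ha0
    · rcases lt_trichotomy b (n + 2) with hb2 | rfl | hb2
      · have := h2 ⟨0, by omega⟩
        simp only at this
        omega
      · exact Or.inl ⟨rfl, rfl⟩
      · exact Or.inr (Or.inl ⟨⟨2 * n + 2 - b, by omega⟩, rfl, by simp only; omega⟩)
    · rcases lt_trichotomy b (n + 2) with hb2 | rfl | hb2
      · have := h2 ⟨a, by omega⟩
        simp only at this
        omega
      · exact Or.inr (Or.inr ⟨⟨a - 1, by omega⟩, by simp only; omega, rfl⟩)
      · rcases lt_or_ge a (n + 2) with h | h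
        · omega
        · have := h1 ⟨2 * n + 2 - (a + 1), by omega⟩
          simp only at this
          omega

/-- The triangulation with diagonals `AD`, `A uᵢ` and `D vⱼ`. -/
def Tminus (n : ℕ) : PolygonTriangulation (2 * n + 4) where
  diagonals := {d | d = (A n, D n) ∨ (∃ i, d = (A n, u n i)) ∨ (∃ j, d = (v n j, D n))}
  isDiagonal := by
    rintro d (rfl | ⟨i, rfl⟩ | ⟨i, rfl⟩) <;>
      simp only [IsPolygonDiagonal, IsPolygonSide, A, D, u, v, Fin.lt_def] <;> omega
  noncrossing := by
    rintro d (rfl | ⟨i, rfl⟩ | ⟨i, rfl⟩) e (rfl | ⟨j, rfl⟩ | ⟨j, rfl⟩) <;>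
      simp only [SegmentsCross, A, D, u, v, Fin.lt_def] <;> omega
  maximal := by
    rintro ⟨⟨a, ha⟩, ⟨b, hb⟩⟩ hd hc
    simp only [IsPolygonDiagonal, IsPolygonSide, Fin.lt_def] at hd
    have h0 := hc (A n, D n) (Or.inl rfl)
    have h1 : ∀ i : Fin n, _ := fun i => hc (A n, u n i) (Or.inr (Or.inl ⟨i, rfl⟩))
    have h2 : ∀ j : Fin n, _ := fun j => hc (v n j, D n) (Or.inr (Or.inr ⟨j, rfl⟩))
    simp only [SegmentsCross, A, D, u, v, Fin.lt_def] at h0 h1 h2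
    simp only [Set.mem_ofPred_eq, A, D, u, v, Prod.mk.injEq, Fin.mk.injEq]
    rcases lt_trichotomy a (n + 1) with ha1 | rfl | ha1
    · rcases lt_or_ge b (n + 2) with hb2 | hb2
      · have := h2 ⟨a, by omega⟩
        simp only at this
        omega
      · rcases Nat.lt_or_ge b (2 * n + 3) with hb3 | hb3
        · omega
        · exact Or.inr (Or.inr ⟨⟨a - 1, by omega⟩, by simp only; omega, by omega⟩)
    · rcases Nat.lt_or_ge b (2 * n + 3) with hb3 | hb3
      · exact Or.inr (Or.inl ⟨⟨2 * n + 2 - b, by omega⟩, rfl, by simp only; omega⟩)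
      · exact Or.inl ⟨rfl, by omega⟩
    · have := h1 ⟨2 * n + 2 - (a + 1), by omega⟩
      simp only at this
      omega

end SigmaPolygon

/-! ### Tetrahedral decompositions -/

/-- `m` tetrahedra with vertices among `k` points, glued along faces.  Every tetrahedron has four
distinct vertices, and a face of a tetrahedron is given by the set of its vertices.
`glued s i j` says that the tetrahedra `i` and `j` both have a face with vertex set `s` and that
these two faces are identified (by the affine map that fixes the vertices).  Tetrahedra with a
common vertex are always glued there, but two faces with the same vertices need not be
identified: the simplicial complexes are the case in which they always are. -/
structure TetComplex (m k : ℕ) where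
  verts : Fin m → Finset (Fin k)
  card_verts : ∀ i, (verts i).card = 4
  glued : Finset (Fin k) → Fin m → Fin m → Prop
  glued_self_iff : ∀ s i, glued s i i ↔ s ⊆ verts i
  glued_symm : ∀ s i j, glued s i j → glued s j i
  glued_trans : ∀ s i j l, glued s i j → glued s j l → glued s i l
  /-- identified faces have their own faces identified -/
  glued_mono : ∀ s t i j, t ⊆ s → glued s i j → glued t i j
  glued_vertex : ∀ w i j, w ∈ verts i → w ∈ verts j → glued {w} i j
  /-- different tetrahedra are not identified as a whole -/
  glued_tetrahedron : ∀ i j, glued (verts i) i j → i = j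

namespace TetComplex

variable {m k : ℕ}

/-- The points of the disjoint union of the `m` tetrahedra, in barycentric coordinates. -/
def Point (K : TetComplex m k) : Type :=
  {p : Fin m × (Fin k → ℝ) // p.2 ∈ stdSimplex ℝ (Fin k) ∧ ∀ w, w ∉ K.verts p.1 → p.2 w = 0}

instance (K : TetComplex m k) : TopologicalSpace K.Point :=
  inferInstanceAs (TopologicalSpace
    {p : Fin m × (Fin k → ℝ) // p.2 ∈ stdSimplex ℝ (Fin k) ∧ ∀ w, w ∉ K.verts p.1 → p.2 w = 0})

/-- Two points are identified when they have the same barycentric coordinates and lie in faces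
that are glued. -/
def pointSetoid (K : TetComplex m k) : Setoid K.Point where
  r p q := p.1.2 = q.1.2 ∧ ∃ s, K.glued s p.1.1 q.1.1 ∧ ∀ w, w ∉ s → p.1.2 w = 0
  iseqv :=
    { refl := fun p => ⟨rfl, K.verts p.1.1, (K.glued_self_iff _ _).2 subset_rfl, p.2.2⟩
      symm := by
        rintro p q ⟨h, s, hs, h0⟩
        exact ⟨h.symm, s, K.glued_symm _ _ _ hs, fun w hw => h ▸ h0 w hw⟩
      trans := by
        rintro p q r ⟨h, s, hs, h0⟩ ⟨h', t, ht, h0'⟩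
        refine ⟨h.trans h', s ∩ t,
          K.glued_trans _ _ _ _ (K.glued_mono _ _ _ _ Finset.inter_subset_left hs)
            (K.glued_mono _ _ _ _ Finset.inter_subset_right ht), fun w hw => ?_⟩
        by_cases hws : w ∈ s
        · rw [h]
          exact h0' w fun hwt => hw (Finset.mem_inter.2 ⟨hws, hwt⟩)
        · exact h0 w hws }

/-- The space obtained from the `m` tetrahedra by the gluing, with the quotient topology. -/
abbrev Realization (K : TetComplex m k) : Type := Quotient K.pointSetoid

/-- The glued space is a closed three-dimensional ball. -/
def IsBall (K : TetComplex m k) : Prop :=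
  Nonempty (K.Realization ≃ₜ Metric.closedBall (0 : EuclideanSpace ℝ (Fin 3)) 1)

/-- The triangular face `s` of the tetrahedron `i` is glued to no other tetrahedron.  In a
triangulated ball these are the triangles that make up the bounding sphere. -/
def IsBoundaryFace (K : TetComplex m k) (i : Fin m) (s : Finset (Fin k)) : Prop :=
  s ⊆ K.verts i ∧ s.card = 3 ∧ ∀ j, K.glued s i j → j = i

/-- The boundary of `K` is the triangulated surface with set of triangles `τ`; the vertices of `τ`
are vertices of `K` through `e`. -/
def HasBoundary {V : Type} (K : TetComplex m k) (e : V ↪ Fin k) (τ : Set (Finset V)) : Prop :=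
  (∀ i s, K.IsBoundaryFace i s → ∃ t ∈ τ, s = t.map e) ∧
    ∀ t ∈ τ, ∃! i, K.IsBoundaryFace i (t.map e)

end TetComplex

/-- There is a tetrahedral decomposition extending `τ` with `m` tetrahedra: a triangulation of the
ball by `m` tetrahedra, possibly with vertices in the interior, whose boundary is `τ`. -/
def HasTetDecomposition {V : Type} (τ : Set (Finset V)) (m : ℕ) : Prop :=
  ∃ (k : ℕ) (K : TetComplex m k) (e : V ↪ Fin k), K.IsBall ∧ K.HasBoundary e τ

/-- The smallest number of tetrahedra in a tetrahedral decomposition extending `τ`.  (A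
decomposition has at least one tetrahedron, so the value is `0` only if there is none.) -/
noncomputable def tet {V : Type} (τ : Set (Finset V)) : ℕ :=
  sInf {m | HasTetDecomposition τ m}

/-! Let L be the path `0, …, n + 1` (that is B, v₁, …, vₙ, A) and U the path `n + 2, …, 2 n + 3`
(that is C, uₙ, …, u₁, D). The triangles of τₙ are the 4n + 4 joins of an edge of one path with an
end of the other.

Lower bound. Four points span at most two triangles of τₙ (`card_triangles_of_card_four`), so with
at most 2n + 2 tetrahedra each of them carries exactly two boundary triangles. The tetrahedron on
the triangle B u₁ D has a second boundary triangle, which shares an edge with the first, so its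
fourth vertex is v₁, A or u₂. In each case some face is interior, and the neighbour across it, which
also needs two boundary triangles (`exists_adjacent`), can only have the same four vertices. These
four points would then span three triangles of τₙ, a contradiction (`verts_ne_of_boundary_face`).

Upper bound. Join every edge of L with C and D, every edge of U with A and B, and add the
tetrahedron ABCD. The boundary is an incidence check (`joinComplex_hasBoundary`). For the ball, a
piecewise linear map carries the complex bijectively onto a convex body: the first two coordinates
are the moments of the weights on U and on L, and the third stacks the tetrahedra over U above ABCD
and those over L below it (`IsJoinPoint.ext`, `exists_isJoinPoint`). -/

/-! ### The triangles of τₙ in arithmetic form -/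

/-- The triangulation `τₙ` of the sphere. -/
abbrev tau (n : ℕ) : Set (Finset (Fin (2 * n + 4))) :=
  sphereTriangulation (SigmaPolygon.Tplus n) (SigmaPolygon.Tminus n)

/-- `w` is the apex and `p q` the base edge of a triangle of `τₙ`: the vertices `0, …, n + 1` and
`n + 2, …, 2 n + 3` form two paths, and the apex is an end of the path not containing the base. -/
def IsApexBase (n w p q : ℕ) : Prop :=
  (p + 1 = q ∨ q + 1 = p) ∧
    ((p ≤ n + 1 ∧ q ≤ n + 1 ∧ (w = n + 2 ∨ w = 2 * n + 3)) ∨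
      (n + 2 ≤ p ∧ n + 2 ≤ q ∧ (w = 0 ∨ w = n + 1)))

/-- `a, b, c` are the vertices of a triangle of `τₙ`. -/
def IsTauTriple (n a b c : ℕ) : Prop :=
  IsApexBase n a b c ∨ IsApexBase n b a c ∨ IsApexBase n c a b

/-- Sides and diagonals merge into one condition on labels: consecutive, or from B = `0` into U, or
from L to C = `n + 2`. Membership thereby becomes linear arithmetic. -/
lemma mem_Tplus_triangles (n : ℕ) (a b c : Fin (2 * n + 4)) (hab : a < b) (hbc : b < c) :
    ({a, b, c} : Finset _) ∈ (SigmaPolygon.Tplus n).triangles ↔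
      ∀ p ∈ [(a, b), (b, c), (a, c)], (p.1 : ℕ) + 1 = p.2 ∨
        (p.1 : ℕ) = 0 ∧ n + 2 ≤ (p.2 : ℕ) ∨ (p.2 : ℕ) = n + 2 ∧ (p.1 : ℕ) ≤ n := by
  have key : ∀ x y : Fin (2 * n + 4), x < y → ((IsPolygonSide (x, y) ∨
      (x, y) ∈ (SigmaPolygon.Tplus n).diagonals) ↔ ((x : ℕ) + 1 = y ∨
        (x : ℕ) = 0 ∧ n + 2 ≤ (y : ℕ) ∨ (y : ℕ) = n + 2 ∧ (x : ℕ) ≤ n)) := by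
    rintro ⟨x, hx⟩ ⟨y, hy⟩ hxy
    simp only [IsPolygonSide, SigmaPolygon.Tplus, SigmaPolygon.B, SigmaPolygon.C, SigmaPolygon.u,
      SigmaPolygon.v, Set.mem_ofPred_eq, Prod.mk.injEq, Fin.mk.injEq, Fin.lt_def] at hxy ⊢
    constructor
    · rintro (h | h | ⟨i, h⟩ | ⟨i, h⟩) <;> omega
    · intro h
      by_cases h1 : x + 1 = y ∨ x = 0 ∧ y + 1 = 2 * n + 4
      · exact Or.inl ⟨hxy, h1⟩
      by_cases h2 : x = 0 ∧ y = n + 2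
      · exact Or.inr (Or.inl h2)
      by_cases h3 : x = 0
      · exact Or.inr (Or.inr (Or.inl ⟨⟨2 * n + 2 - y, by omega⟩, h3, by simp only; omega⟩))
      · exact Or.inr (Or.inr (Or.inr ⟨⟨x - 1, by omega⟩, by simp only; omega, by omega⟩))
  have hac := hab.trans hbc
  have hcard : ({a, b, c} : Finset (Fin (2 * n + 4))).card = 3 :=
    Finset.card_eq_three.2 ⟨a, b, c, hab.ne, hac.ne, hbc.ne, rfl⟩
  simp only [PolygonTriangulation.triangles, Set.mem_ofPred_eq, hcard, true_and,
    Finset.mem_insert, Finset.mem_singleton, forall_eq_or_imp, forall_eq, List.mem_cons,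
    List.not_mem_nil, or_false, lt_irrefl, hab, hbc, hac, hab.not_gt, hbc.not_gt, hac.not_gt,
    false_imp_iff, true_imp_iff, true_and, and_true]
  rw [key _ _ hab, key _ _ hbc, key _ _ hac]
  tauto

lemma mem_Tminus_triangles (n : ℕ) (a b c : Fin (2 * n + 4)) (hab : a < b) (hbc : b < c) :
    ({a, b, c} : Finset _) ∈ (SigmaPolygon.Tminus n).triangles ↔
      ∀ p ∈ [(a, b), (b, c), (a, c)], (p.1 : ℕ) + 1 = p.2 ∨
        (p.2 : ℕ) = 2 * n + 3 ∧ (p.1 : ℕ) ≤ n + 1 ∨ (p.1 : ℕ) = n + 1 ∧ n + 3 ≤ (p.2 : ℕ) := by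
  have key : ∀ x y : Fin (2 * n + 4), x < y → ((IsPolygonSide (x, y) ∨
      (x, y) ∈ (SigmaPolygon.Tminus n).diagonals) ↔ ((x : ℕ) + 1 = y ∨
        (y : ℕ) = 2 * n + 3 ∧ (x : ℕ) ≤ n + 1 ∨ (x : ℕ) = n + 1 ∧ n + 3 ≤ (y : ℕ))) := by
    rintro ⟨x, hx⟩ ⟨y, hy⟩ hxy
    simp only [IsPolygonSide, SigmaPolygon.Tminus, SigmaPolygon.A, SigmaPolygon.D, SigmaPolygon.u,
      SigmaPolygon.v, Set.mem_ofPred_eq, Prod.mk.injEq, Fin.mk.injEq, Fin.lt_def] at hxy ⊢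
    constructor
    · rintro (h | h | ⟨i, h⟩ | ⟨i, h⟩) <;> omega
    · intro h
      by_cases h1 : x + 1 = y ∨ x = 0 ∧ y + 1 = 2 * n + 4
      · exact Or.inl ⟨hxy, h1⟩
      by_cases h2 : x = n + 1 ∧ y = 2 * n + 3
      · exact Or.inr (Or.inl h2)
      by_cases h3 : x = n + 1
      · exact Or.inr (Or.inr (Or.inl ⟨⟨2 * n + 2 - y, by omega⟩, h3, by simp only; omega⟩))
      · exact Or.inr (Or.inr (Or.inr ⟨⟨x - 1, by omega⟩, by simp only; omega, by omega⟩))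
  have hac := hab.trans hbc
  have hcard : ({a, b, c} : Finset (Fin (2 * n + 4))).card = 3 :=
    Finset.card_eq_three.2 ⟨a, b, c, hab.ne, hac.ne, hbc.ne, rfl⟩
  simp only [PolygonTriangulation.triangles, Set.mem_ofPred_eq, hcard, true_and,
    Finset.mem_insert, Finset.mem_singleton, forall_eq_or_imp, forall_eq, List.mem_cons,
    List.not_mem_nil, or_false, lt_irrefl, hab, hbc, hac, hab.not_gt, hbc.not_gt, hac.not_gt,
    false_imp_iff, true_imp_iff, true_and, and_true]
  rw [key _ _ hab, key _ _ hbc, key _ _ hac]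
  tauto

lemma mem_tau_of_lt (n : ℕ) (a b c : Fin (2 * n + 4)) (hab : a < b) (hbc : b < c) :
    ({a, b, c} : Finset _) ∈ tau n ↔ IsTauTriple n a b c := by
  rw [tau, sphereTriangulation, Set.mem_union, mem_Tplus_triangles n a b c hab hbc,
    mem_Tminus_triangles n a b c hab hbc]
  have := a.2
  have := b.2
  have := c.2
  simp only [List.mem_cons, List.not_mem_nil, or_false, forall_eq_or_imp, forall_eq, IsTauTriple,
    IsApexBase, Fin.lt_def] at *
  omega

lemma card_of_mem_tau {n : ℕ} {t : Finset (Fin (2 * n + 4))} (ht : t ∈ tau n) : t.card = 3 :=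
  ht.elim (·.1) (·.1)

lemma IsTauTriple.ne {n a b c : ℕ} (h : IsTauTriple n a b c) : a ≠ b ∧ b ≠ c ∧ a ≠ c := by
  simp only [IsTauTriple, IsApexBase] at h
  omega

lemma isApexBase_comm {n w p q : ℕ} : IsApexBase n w p q ↔ IsApexBase n w q p := by
  unfold IsApexBase
  tauto

lemma isTauTriple_swap_left {n a b c : ℕ} : IsTauTriple n a b c ↔ IsTauTriple n b a c := by
  unfold IsTauTriple
  rw [isApexBase_comm (w := c)]
  tauto

lemma isTauTriple_swap_right {n a b c : ℕ} : IsTauTriple n a b c ↔ IsTauTriple n a c b := by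
  unfold IsTauTriple
  rw [isApexBase_comm (w := a)]
  tauto

lemma mem_tau_iff {n : ℕ} {a b c : Fin (2 * n + 4)} :
    ({a, b, c} : Finset _) ∈ tau n ↔ IsTauTriple n a b c := by
  have main : ∀ a b c : Fin (2 * n + 4), a ≠ b → b ≠ c → a ≠ c →
      (({a, b, c} : Finset _) ∈ tau n ↔ IsTauTriple n a b c) := by
    have h2 : ∀ a b c : Fin (2 * n + 4), a < b → b ≠ c → a ≠ c →
        (({a, b, c} : Finset _) ∈ tau n ↔ IsTauTriple n a b c) := by
      intro a b c hab hbc hac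
      rcases lt_or_gt_of_ne hbc with h | h
      · exact mem_tau_of_lt n a b c hab h
      rcases lt_or_gt_of_ne hac with h' | h'
      · rw [isTauTriple_swap_right, ← mem_tau_of_lt n a c b h' h, Finset.pair_comm]
      · rw [isTauTriple_swap_right, isTauTriple_swap_left, ← mem_tau_of_lt n c a b h' hab,
          Finset.pair_comm, Finset.insert_comm]
    intro a b c hab hbc hac
    rcases lt_or_gt_of_ne hab with h | h
    · exact h2 a b c h hbc hac
    · rw [isTauTriple_swap_left, ← h2 b a c h hac hbc, Finset.insert_comm]
  constructor
  · intro h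
    have hc := card_of_mem_tau h
    refine (main a b c ?_ ?_ ?_).1 h <;> rintro rfl
    · have := Finset.card_le_two (a := a) (b := c); simp at hc; omega
    · have := Finset.card_le_two (a := a) (b := b); simp at hc; omega
    · have := Finset.card_le_two (a := b) (b := a)
      rw [Finset.insert_comm] at hc; simp at hc; omega
  · intro h
    obtain ⟨h1, h2, h3⟩ := h.ne
    exact (main a b c (fun e => h1 (e ▸ rfl)) (fun e => h2 (e ▸ rfl)) (fun e => h3 (e ▸ rfl))).2 h

/-! ### Triangles among four points, and their number -/

lemma eq_of_subset_of_ne {α : Type*} [DecidableEq α] {p q r x : α} {t : Finset α}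
    (ht : t.card = 3) (hs : ({p, q, r} : Finset α).card = 3) (hts : t ⊆ {p, q, r, x})
    (hne : t ≠ {p, q, r}) : t = {p, q, x} ∨ t = {p, r, x} ∨ t = {q, r, x} := by
  have key : ∀ a b c : α, t ⊆ {a, b, c} → t = {a, b, c} := fun a b c h =>
    Finset.eq_of_subset_of_card_le h (by rw [ht]; exact Finset.card_le_three)
  have sub : ∀ y, y ∈ t → y = p ∨ y = q ∨ y = r ∨ y = x := fun y hy => by simpa using hts hy
  have drop : ∀ z a b c : α, z ∉ t → (∀ y, y ∈ t → y = z ∨ y = a ∨ y = b ∨ y = c) →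
      t = {a, b, c} := by
    intro z a b c hz h
    refine key a b c fun y hy => ?_
    rcases h y hy with rfl | h
    · exact absurd hy hz
    · simpa using h
  by_cases hp : p ∈ t
  · by_cases hq : q ∈ t
    · by_cases hr : r ∈ t
      · refine absurd (Finset.eq_of_subset_of_card_le (s := {p, q, r}) (t := t) ?_ ?_).symm hne
        · intro y hy
          simp only [Finset.mem_insert, Finset.mem_singleton] at hy
          rcases hy with rfl | rfl | rfl <;> assumption
        · rw [ht, hs]
      · exact Or.inl (drop r p q x hr fun y hy => by have := sub y hy; tauto)
    · exact Or.inr (Or.inl (drop q p r x hq fun y hy => by have := sub y hy; tauto))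
  · exact Or.inr (Or.inr (drop p q r x hp sub))

/-- No vertex of `τₙ` has degree three: four points contain at most two triangles. -/
lemma card_triangles_of_card_four {n : ℕ} (hn : 2 ≤ n) {W : Finset (Fin (2 * n + 4))}
    (hW : W.card ≤ 4) {t₁ t₂ t₃ : Finset (Fin (2 * n + 4))} (h₁ : t₁ ∈ tau n) (h₂ : t₂ ∈ tau n)
    (h₃ : t₃ ∈ tau n) (hs₁ : t₁ ⊆ W) (hs₂ : t₂ ⊆ W) (hs₃ : t₃ ⊆ W) (h₁₂ : t₁ ≠ t₂)
    (h₁₃ : t₁ ≠ t₃) : t₂ = t₃ := by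
  by_contra h₂₃
  -- Padding to exactly four points makes it possible to list them in increasing order.
  wlog hW4 : W.card = 4 generalizing W
  · obtain ⟨W', hW', -, hc⟩ := Finset.exists_subsuperset_card_eq (Finset.subset_univ W) hW
      (by simp)
    exact this hc.le (hs₁.trans hW') (hs₂.trans hW') (hs₃.trans hW') hc
  let f := W.orderEmbOfFin hW4
  obtain ⟨a, b, c, d, hab, hbc, hcd, rfl⟩ : ∃ a b c d, a < b ∧ b < c ∧ c < d ∧
      W = {a, b, c, d} := by
    refine ⟨f 0, f 1, f 2, f 3, f.strictMono (by decide), f.strictMono (by decide),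
      f.strictMono (by decide), ?_⟩
    have h := Finset.image_orderEmbOfFin_univ W hW4
    conv_lhs => rw [← h]
    ext y
    simp only [Finset.mem_image, Finset.mem_univ, true_and, Finset.mem_insert,
      Finset.mem_singleton, f, eq_comm (a := y)]
    exact ⟨fun ⟨i, hi⟩ => by fin_cases i <;> simp_all,
      fun h => by rcases h with h | h | h | h <;> exact ⟨_, h⟩⟩
  have hcard : ({a, b, c} : Finset (Fin (2 * n + 4))).card = 3 :=
    Finset.card_eq_three.2 ⟨a, b, c, hab.ne, (hab.trans hbc).ne, hbc.ne, rfl⟩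
  have h4 : ∀ t, t ∈ tau n → t ⊆ {a, b, c, d} →
      (t = {a, b, c} ∨ t = {a, b, d} ∨ t = {a, c, d} ∨ t = {b, c, d}) := by
    intro t ht hts
    by_cases h : t = {a, b, c}
    · exact Or.inl h
    · exact Or.inr (eq_of_subset_of_ne (card_of_mem_tau ht) hcard hts h)
  have e₁ := mem_tau_of_lt n a b c hab hbc
  have e₂ := mem_tau_of_lt n a b d hab (hbc.trans hcd)
  have e₃ := mem_tau_of_lt n a c d (hab.trans hbc) hcd
  have e₄ := mem_tau_of_lt n b c d hbc hcd
  have hd := d.2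
  rw [Fin.lt_def] at hab hbc hcd
  -- The apex lies on the path that does not contain the base, so in increasing order the base is
  -- the lower pair or the upper pair.
  have sorted : ∀ x y z : ℕ, x < y → y < z → z < 2 * n + 4 → IsTauTriple n x y z →
      (x + 1 = y ∧ y ≤ n + 1 ∧ (z = n + 2 ∨ z = 2 * n + 3)) ∨
      (y + 1 = z ∧ n + 2 ≤ y ∧ (x = 0 ∨ x = n + 1)) := by
    intro x y z h1 h2 h3 h
    simp only [IsTauTriple, IsApexBase] at h
    omega
  have s₁ := fun h => sorted _ _ _ hab hbc (by omega) (e₁.1 h)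
  have s₂ := fun h => sorted _ _ _ hab (hbc.trans hcd) (by omega) (e₂.1 h)
  have s₃ := fun h => sorted _ _ _ (hab.trans hbc) hcd (by omega) (e₃.1 h)
  have s₄ := fun h => sorted _ _ _ hbc hcd (by omega) (e₄.1 h)
  clear e₁ e₂ e₃ e₄
  have three : ∀ P Q R S : Finset (Fin (2 * n + 4)), (P ∈ tau n → Q ∈ tau n → R ∈ tau n → False) →
      (P ∈ tau n → Q ∈ tau n → S ∈ tau n → False) → (P ∈ tau n → R ∈ tau n → S ∈ tau n → False) →
      (Q ∈ tau n → R ∈ tau n → S ∈ tau n → False) → (∀ t, t ∈ tau n → t ⊆ {a, b, c, d} →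
      (t = P ∨ t = Q ∨ t = R ∨ t = S)) → False := by
    intro P Q R S f₁ f₂ f₃ f₄ h
    rcases h t₁ h₁ hs₁ with rfl | rfl | rfl | rfl <;> rcases h t₂ h₂ hs₂ with rfl | rfl | rfl | rfl <;>
      rcases h t₃ h₃ hs₃ with rfl | rfl | rfl | rfl <;>
      first
        | exact h₁₂ rfl
        | exact h₁₃ rfl
        | exact h₂₃ rfl
        | exact f₁ ‹_› ‹_› ‹_›
        | exact f₂ ‹_› ‹_› ‹_›
        | exact f₃ ‹_› ‹_› ‹_›
        | exact f₄ ‹_› ‹_› ‹_›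
  refine three _ _ _ _ ?_ ?_ ?_ ?_ h4
  · intro p q r
    have := s₁ p; have := s₂ q; have := s₃ r; omega
  · intro p q r
    have := s₁ p; have := s₂ q; have := s₄ r; omega
  · intro p q r
    have := s₁ p; have := s₃ q; have := s₄ r; omega
  · intro p q r
    have := s₂ p; have := s₃ q; have := s₄ r; omega

open Classical in
/-- The set of triangles of `τₙ`, as a finset. -/
noncomputable def tauFinset (n : ℕ) : Finset (Finset (Fin (2 * n + 4))) :=
  Finset.univ.filter (· ∈ tau n)

lemma mem_tauFinset {n : ℕ} {t : Finset (Fin (2 * n + 4))} : t ∈ tauFinset n ↔ t ∈ tau n := by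
  simp [tauFinset]

/-- A triangle is encoded by the position of its base edge, a bit for the path of the base, and a
bit for the end of the other path that is the apex. -/
lemma le_card_tauFinset (n : ℕ) : 4 * n + 4 ≤ (tauFinset n).card := by
  let p : Fin (n + 1) × Bool × Bool → Fin (2 * n + 4) × Fin (2 * n + 4) × Fin (2 * n + 4) :=
    fun x => (⟨x.1 + if x.2.1 then n + 2 else 0, by have := x.1.2; split <;> omega⟩,
      ⟨x.1 + 1 + if x.2.1 then n + 2 else 0, by have := x.1.2; split <;> omega⟩,
      ⟨(if x.2.1 then 0 else n + 2) + if x.2.2 then n + 1 else 0, by split <;> split <;> omega⟩)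
  have h : Fintype.card (Fin (n + 1) × Bool × Bool) ≤ (tauFinset n).card := by
    refine Finset.card_le_card_of_injOn (s := Finset.univ)
      (fun x => ({(p x).1, (p x).2.1, (p x).2.2} : Finset _)) ?_ ?_
    · rintro ⟨i, β, γ⟩ -
      rw [Finset.mem_coe, mem_tauFinset, mem_tau_iff]
      have := i.2
      refine Or.inr (Or.inr ?_)
      cases β <;> cases γ <;> simp [p, IsApexBase] <;> omega
    · rintro ⟨⟨i, hi⟩, β, γ⟩ - ⟨⟨j, hj⟩, β', γ'⟩ - h
      have sub := fun y => (Finset.ext_iff.1 h y).1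
      have h1 := sub (p (⟨i, hi⟩, β, γ)).1 (by simp)
      have h2 := sub (p (⟨i, hi⟩, β, γ)).2.1 (by simp)
      have h3 := sub (p (⟨i, hi⟩, β, γ)).2.2 (by simp)
      simp only [Finset.mem_insert, Finset.mem_singleton, p, Fin.ext_iff] at h1 h2 h3
      clear h sub p
      cases β <;> cases γ <;> cases β' <;> cases γ' <;> simp at h1 h2 h3 ⊢ <;> omega
  refine le_trans (le_of_eq ?_) h
  simp
  ring

/-! ### The lower bound -/

namespace TetComplex
variable {m k n : ℕ} {K : TetComplex m k} {e : Fin (2 * n + 4) ↪ Fin k}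

/-- At most four vertices of τₙ map into `K.verts i`; vertices of `K` outside the range of `e` only
lower this number. -/
lemma eq_of_boundary_faces (hn : 2 ≤ n) {i : Fin m} {t₁ t₂ t₃ : Finset (Fin (2 * n + 4))}
    (h₁ : t₁ ∈ tau n) (h₂ : t₂ ∈ tau n) (h₃ : t₃ ∈ tau n) (hs₁ : t₁.map e ⊆ K.verts i)
    (hs₂ : t₂.map e ⊆ K.verts i) (hs₃ : t₃.map e ⊆ K.verts i) (h₁₂ : t₁ ≠ t₂) (h₁₃ : t₁ ≠ t₃) :
    t₂ = t₃ := by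
  classical
  have hsub : ∀ t : Finset (Fin (2 * n + 4)), t.map e ⊆ K.verts i →
      t ⊆ Finset.univ.filter (fun x => e x ∈ K.verts i) := by
    intro t ht x hx
    simpa using ht (Finset.mem_map_of_mem e hx)
  refine card_triangles_of_card_four hn ?_ h₁ h₂ h₃ (hsub _ hs₁) (hsub _ hs₂) (hsub _ hs₃) h₁₂ h₁₃
  rw [← Finset.card_map e]
  refine le_trans ?_ (K.card_verts i).le
  refine Finset.card_le_card fun y hy => ?_
  obtain ⟨x, hx, rfl⟩ := Finset.mem_map.1 hy
  simpa using hx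

/-- With at most `2 n + 2` tetrahedra, every tetrahedron has two triangles on the boundary. -/
lemma exists_two_boundary_faces (hn : 2 ≤ n) (hK : K.HasBoundary e (tau n))
    (hm : m ≤ 2 * n + 2) (i : Fin m) : ∃ t₁ ∈ tau n, ∃ t₂ ∈ tau n, t₁ ≠ t₂ ∧
      K.IsBoundaryFace i (t₁.map e) ∧ K.IsBoundaryFace i (t₂.map e) := by
  classical
  have hg : ∀ t : Finset (Fin (2 * n + 4)), ∃ j : Fin m, t ∈ tau n →
      K.IsBoundaryFace j (t.map e) := by
    intro t
    by_cases ht : t ∈ tau n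
    · exact (hK.2 t ht).exists.imp fun j hj _ => hj
    · exact ⟨i, fun h => absurd h ht⟩
  choose g hg using hg
  have hle : ∀ j ∈ Finset.univ, ((tauFinset n).filter (g · = j)).card ≤ 2 := by
    intro j _
    by_contra! h
    obtain ⟨t₁, t₂, t₃, h₁, h₂, h₃, h₁₂, h₁₃, h₂₃⟩ := Finset.two_lt_card_iff.1 h
    simp only [Finset.mem_filter, mem_tauFinset] at h₁ h₂ h₃
    exact h₂₃ (eq_of_boundary_faces hn h₁.1 h₂.1 h₃.1 (h₁.2 ▸ (hg _ h₁.1).1)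
      (h₂.2 ▸ (hg _ h₂.1).1) (h₃.2 ▸ (hg _ h₃.1).1) h₁₂ h₁₃)
  -- All fibres of `g` have at most two elements; a smaller fibre over `i` would give fewer than 2m
  -- ≤ 4n + 4 triangles.
  have hi : 1 < ((tauFinset n).filter (g · = i)).card := by
    by_contra! h
    have hlt := Finset.sum_lt_sum hle ⟨i, Finset.mem_univ i, by omega⟩
    rw [← Finset.card_eq_sum_card_fiberwise fun t _ => Finset.mem_coe.2 (Finset.mem_univ (g t))]
      at hlt
    have := le_card_tauFinset n
    simp at hlt
    omega
  obtain ⟨t₁, h₁, t₂, h₂, h₁₂⟩ := Finset.one_lt_card.1 hi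
  simp only [Finset.mem_filter, mem_tauFinset] at h₁ h₂
  exact ⟨t₁, h₁.1, t₂, h₂.1, h₁₂, h₁.2 ▸ hg _ h₁.1, h₂.2 ▸ hg _ h₂.1⟩

/-- The face `s` of the tetrahedron `i` is not on the boundary, so with at most `2 n + 2`
tetrahedra the vertices of `s` form, with one more vertex, a set containing two triangles. -/
lemma exists_adjacent (hn : 2 ≤ n) (hK : K.HasBoundary e (tau n)) (hm : m ≤ 2 * n + 2)
    {i : Fin m} {p q r : Fin (2 * n + 4)} (hs : ({p, q, r} : Finset _).map e ⊆ K.verts i)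
    (hc : ({p, q, r} : Finset (Fin (2 * n + 4))).card = 3) (hst : ¬ IsTauTriple n p q r) :
    ∃ j y, j ≠ i ∧ K.verts j = ({p, q, r, y} : Finset _).map e ∧
      (IsTauTriple n p q y ∧ IsTauTriple n p r y ∨ IsTauTriple n p q y ∧ IsTauTriple n q r y ∨
        IsTauTriple n p r y ∧ IsTauTriple n q r y) := by
  rw [← mem_tau_iff] at hst
  obtain ⟨j, hj, hji⟩ : ∃ j, K.glued (({p, q, r} : Finset _).map e) i j ∧ j ≠ i := by
    by_contra! h
    obtain ⟨t, ht, h'⟩ := hK.1 i _ ⟨hs, by rw [Finset.card_map, hc], h⟩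
    exact hst (Finset.map_injective e h' ▸ ht)
  have hsj := (K.glued_self_iff _ j).1 (K.glued_trans _ _ _ _ (K.glued_symm _ _ _ hj) hj)
  obtain ⟨t₁, h₁, t₂, h₂, h₁₂, b₁, b₂⟩ := exists_two_boundary_faces hn hK hm j
  -- A boundary triangle of `j` differs from the interior face, so it uses the fourth vertex of `j`,
  -- which is therefore a vertex of τₙ.
  obtain ⟨y, hy, hys⟩ : ∃ y ∈ t₁, y ∉ ({p, q, r} : Finset (Fin (2 * n + 4))) := by
    by_contra! h
    exact hst (Finset.eq_of_subset_of_card_le h (by rw [hc, card_of_mem_tau h₁]) ▸ h₁)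
  have hyv : e y ∈ K.verts j := b₁.1 (Finset.mem_map_of_mem e hy)
  have hv : K.verts j = ({p, q, r, y} : Finset _).map e := by
    have hins : ({p, q, r, y} : Finset (Fin (2 * n + 4))) = insert y {p, q, r} := by
      ext z; simp; tauto
    symm
    apply Finset.eq_of_subset_of_card_le
    · rw [hins, Finset.map_insert]
      exact Finset.insert_subset hyv hsj
    · rw [hins, Finset.card_map, Finset.card_insert_of_notMem hys, hc, K.card_verts]
  refine ⟨j, y, hji, hv, ?_⟩
  have hcase : ∀ t, t ∈ tau n → K.IsBoundaryFace j (t.map e) →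
      t = {p, q, y} ∨ t = {p, r, y} ∨ t = {q, r, y} := by
    intro t ht hb
    refine eq_of_subset_of_ne (card_of_mem_tau ht) hc ?_ (fun h => hst (h ▸ ht))
    exact Finset.map_subset_map.1 (hv ▸ hb.1)
  simp only [← mem_tau_iff]
  rcases hcase _ h₁ b₁ with rfl | rfl | rfl <;> rcases hcase _ h₂ b₂ with rfl | rfl | rfl <;>
    first
      | exact absurd rfl h₁₂
      | tauto

/-- A tetrahedron adjacent to `i` along a face `s` cannot have the same vertices as `i`, if `i` has
a boundary face. -/
lemma verts_ne_of_boundary_face (hn : 2 ≤ n) (hK : K.HasBoundary e (tau n)) (hm : m ≤ 2 * n + 2)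
    {i j : Fin m} (hji : j ≠ i) {t : Finset (Fin (2 * n + 4))} (ht : t ∈ tau n)
    (hb : K.IsBoundaryFace i (t.map e)) : K.verts j ≠ K.verts i := by
  intro hv
  obtain ⟨t₁, h₁, t₂, h₂, h₁₂, b₁, b₂⟩ := exists_two_boundary_faces hn hK hm j
  -- A triangle of τₙ bounds only one tetrahedron, so `t` is a third triangle besides the two of
  -- `j`, on the same four points.
  have hne : ∀ t', K.IsBoundaryFace j (t'.map e) → t ≠ t' := by
    rintro t' hb' rfl
    exact hji ((hK.2 t ht).unique hb' hb)
  exact h₁₂ (eq_of_boundary_faces hn ht h₁ h₂ (hv ▸ hb.1) b₁.1 b₂.1 (hne _ b₁) (hne _ b₂))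

theorem le_of_hasBoundary (hn : 2 ≤ n) (hK : K.HasBoundary e (tau n)) : 2 * n + 3 ≤ m := by
  by_contra! hlt
  have hm : m ≤ 2 * n + 2 := by omega
  obtain ⟨p, hp⟩ : ∃ p : Fin (2 * n + 4), (p : ℕ) = 0 := ⟨⟨0, by omega⟩, rfl⟩
  obtain ⟨q, hq⟩ : ∃ q : Fin (2 * n + 4), (q : ℕ) = 2 * n + 2 := ⟨⟨2 * n + 2, by omega⟩, rfl⟩
  obtain ⟨r, hr⟩ : ∃ r : Fin (2 * n + 4), (r : ℕ) = 2 * n + 3 := ⟨⟨2 * n + 3, by omega⟩, rfl⟩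
  have hpqr : IsTauTriple n p q r := by
    exact Or.inl ⟨Or.inl (by omega), Or.inr ⟨by omega, by omega, Or.inl hp⟩⟩
  have hperm₁ : ∀ x, ({x, q, r, p} : Finset (Fin (2 * n + 4))) = {p, q, r, x} := by
    intro x; ext; simp; tauto
  have hperm₂ : ∀ x, ({x, p, r, q} : Finset (Fin (2 * n + 4))) = {p, q, r, x} := by
    intro x; ext; simp; tauto
  have ht := mem_tau_iff.2 hpqr
  obtain ⟨i, hb, -⟩ := hK.2 _ ht
  obtain ⟨t₁, h₁, h₁', b₁⟩ : ∃ t ∈ tau n, t ≠ {p, q, r} ∧ K.IsBoundaryFace i (t.map e) := by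
    obtain ⟨t₁, h₁, t₂, h₂, h₁₂, b₁, b₂⟩ := exists_two_boundary_faces hn hK hm i
    by_cases h : t₁ = {p, q, r}
    · exact ⟨t₂, h₂, fun h' => h₁₂ (h.trans h'.symm), b₂⟩
    · exact ⟨t₁, h₁, h, b₁⟩
  have hc := card_of_mem_tau ht
  obtain ⟨x, hx, hxs⟩ : ∃ x ∈ t₁, x ∉ ({p, q, r} : Finset (Fin (2 * n + 4))) := by
    by_contra! h
    exact h₁' (Finset.eq_of_subset_of_card_le h (by rw [hc, card_of_mem_tau h₁]))
  have hins : ({p, q, r, x} : Finset (Fin (2 * n + 4))) = insert x {p, q, r} := by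
    ext z; simp; tauto
  have hv : K.verts i = ({p, q, r, x} : Finset _).map e := by
    symm
    apply Finset.eq_of_subset_of_card_le
    · rw [hins, Finset.map_insert]
      exact Finset.insert_subset (b₁.1 (Finset.mem_map_of_mem e hx)) hb.1
    · rw [hins, Finset.card_map, Finset.card_insert_of_notMem hxs, hc, K.card_verts]
  have hx' : IsTauTriple n p q x ∨ IsTauTriple n p r x ∨ IsTauTriple n q r x := by
    simp only [← mem_tau_iff]
    rcases eq_of_subset_of_ne (card_of_mem_tau h₁) hc
      (Finset.map_subset_map.1 (hv ▸ b₁.1)) h₁' with rfl | rfl | rfl <;> tauto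
  -- an interior face of `i` and the only possible fourth vertex of a neighbour there
  have finish : ∀ a b c z : Fin (2 * n + 4), ({a, b, c, z} : Finset _) = {p, q, r, x} →
      ({a, b, c} : Finset (Fin (2 * n + 4))).card = 3 → ¬ IsTauTriple n a b c →
      (∀ y : Fin (2 * n + 4), IsTauTriple n a b y ∧ IsTauTriple n a c y ∨
        IsTauTriple n a b y ∧ IsTauTriple n b c y ∨
        IsTauTriple n a c y ∧ IsTauTriple n b c y → y = z) → False := by
    intro a b c z hset hcard hnt hy
    obtain ⟨j, y, hji, hvj, h⟩ := exists_adjacent hn hK hm (i := i) (p := a) (q := b) (r := c)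
      (by
        rw [hv, ← hset]
        refine Finset.map_subset_map.2 fun w hw => ?_
        simp at hw ⊢
        tauto) hcard hnt
    obtain rfl := hy y h
    exact verts_ne_of_boundary_face hn hK hm hji ht hb (by rw [hvj, hv, hset])
  have hxv : (x : ℕ) ≠ 0 ∧ (x : ℕ) ≠ 2 * n + 2 ∧ (x : ℕ) ≠ 2 * n + 3 := by
    simpa only [Finset.mem_insert, Finset.mem_singleton, Fin.ext_iff, hp, hq, hr, not_or] using hxs
  -- The triangles across the edges BD, u₁D and Bu₁ of B u₁ D have third vertices v₁, A and u₂.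
  have hcases : (x : ℕ) = 1 ∨ (x : ℕ) = n + 1 ∨ (x : ℕ) = 2 * n + 1 := by
    rcases hx' with h | h | h <;> simp only [hp, hq, hr, IsTauTriple, IsApexBase] at h <;> omega
  have card3 : ∀ a b c : Fin (2 * n + 4), (a : ℕ) ≠ b → (a : ℕ) ≠ c → (b : ℕ) ≠ c →
      ({a, b, c} : Finset (Fin (2 * n + 4))).card = 3 := fun a b c h₁ h₂ h₃ =>
    Finset.card_eq_three.2 ⟨a, b, c, fun h => h₁ (h ▸ rfl), fun h => h₂ (h ▸ rfl),
      fun h => h₃ (h ▸ rfl), rfl⟩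
  rcases hcases with h | h | h
  -- Face v₁ u₁ D: v₁u₁ is not an edge of τₙ, v₁D leads to B or v₂, and u₁D to B or A. As n ≥ 2, v₂
  -- ≠ A, which leaves B.
  · refine finish x q r p (hperm₁ x) (card3 _ _ _ (by omega) (by omega) (by omega))
      ?_ fun y hy => ?_
    · simp only [hq, hr, h, IsTauTriple, IsApexBase]; omega
    · have h₁ : ¬ IsTauTriple n x q y := by
        simp only [hq, h, IsTauTriple, IsApexBase]; omega
      have h₂ : IsTauTriple n x r y → (y : ℕ) = 0 ∨ (y : ℕ) = 2 := by
        simp only [hr, h, IsTauTriple, IsApexBase]; omega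
      have h₃ : IsTauTriple n q r y → (y : ℕ) = 0 ∨ (y : ℕ) = n + 1 := by
        simp only [hq, hr, IsTauTriple, IsApexBase]; omega
      rw [Fin.ext_iff]
      have := (by clear h₂ h₃; tauto : IsTauTriple n x r y ∧ IsTauTriple n q r y)
      have h₂ := h₂ this.1
      have h₃ := h₃ this.2
      clear finish
      omega
  -- Face A B D: AB is not an edge, AD leads to vₙ or u₁, and BD to v₁ or u₁. As n ≥ 2, vₙ ≠ v₁,
  -- which leaves u₁.
  · refine finish x p r q (hperm₂ x) (card3 _ _ _ (by omega) (by omega) (by omega))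
      ?_ fun y hy => ?_
    · simp only [hp, hr, h, IsTauTriple, IsApexBase]; omega
    · have h₁ : ¬ IsTauTriple n x p y := by
        simp only [hp, h, IsTauTriple, IsApexBase]; omega
      have h₂ : IsTauTriple n x r y → (y : ℕ) = n ∨ (y : ℕ) = 2 * n + 2 := by
        simp only [hr, h, IsTauTriple, IsApexBase]; omega
      have h₃ : IsTauTriple n p r y → (y : ℕ) = 1 ∨ (y : ℕ) = 2 * n + 2 := by
        simp only [hp, hr, IsTauTriple, IsApexBase]; omega
      rw [Fin.ext_iff]
      have := (by clear h₂ h₃; tauto : IsTauTriple n x r y ∧ IsTauTriple n p r y)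
      have h₂ := h₂ this.1
      have h₃ := h₃ this.2
      clear finish
      omega
  -- Face u₂ B D: u₂D is not an edge, u₂B leads to label `2 n` or to u₁, and BD to v₁ or u₁, which
  -- leaves u₁.
  · refine finish x p r q (hperm₂ x) (card3 _ _ _ (by omega) (by omega) (by omega))
      ?_ fun y hy => ?_
    · simp only [hp, hr, h, IsTauTriple, IsApexBase]; omega
    · have h₁ : ¬ IsTauTriple n x r y := by
        simp only [hr, h, IsTauTriple, IsApexBase]; omega
      have h₂ : IsTauTriple n x p y → (y : ℕ) = 2 * n ∨ (y : ℕ) = 2 * n + 2 := by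
        simp only [hp, h, IsTauTriple, IsApexBase]; omega
      have h₃ : IsTauTriple n p r y → (y : ℕ) = 1 ∨ (y : ℕ) = 2 * n + 2 := by
        simp only [hp, hr, IsTauTriple, IsApexBase]; omega
      rw [Fin.ext_iff]
      have := (by clear h₂ h₃; tauto : IsTauTriple n x p y ∧ IsTauTriple n p r y)
      have h₂ := h₂ this.1
      have h₃ := h₃ this.2
      clear finish
      omega

end TetComplex

/-! ### Recognizing a ball: simplicial complexes mapped onto a convex body -/

namespace TetComplex

/-- The simplicial complex with the given tetrahedra: faces with the same vertices coincide. -/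
def ofVerts {m k : ℕ} (verts : Fin m → Finset (Fin k)) (hc : ∀ i, (verts i).card = 4)
    (hinj : Function.Injective verts) : TetComplex m k where
  verts := verts
  card_verts := hc
  glued s i j := s ⊆ verts i ∧ s ⊆ verts j
  glued_self_iff _ _ := and_self_iff
  glued_symm _ _ _ h := h.symm
  glued_trans _ _ _ _ h h' := ⟨h.1, h'.2⟩
  glued_mono _ _ _ _ hts h := ⟨hts.trans h.1, hts.trans h.2⟩
  glued_vertex _ _ _ h h' := ⟨by simpa using h, by simpa using h'⟩
  glued_tetrahedron i j h := hinj (Finset.eq_of_subset_of_card_le h.2 (by rw [hc, hc]))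

/-- The realization of the simplicial complex with tetrahedra `verts` inside the standard simplex. -/
def carrier {m k : ℕ} (verts : Fin m → Finset (Fin k)) : Set (Fin k → ℝ) :=
  {p | p ∈ stdSimplex ℝ (Fin k) ∧ ∃ i, ∀ w, w ∉ verts i → p w = 0}

instance {m k : ℕ} (K : TetComplex m k) : CompactSpace K.Point := by
  have h : {p : Fin m × (Fin k → ℝ) | p.2 ∈ stdSimplex ℝ (Fin k) ∧
      ∀ w, w ∉ K.verts p.1 → p.2 w = 0} = (Prod.snd ⁻¹' stdSimplex ℝ (Fin k)) ∩
      ⋂ w, (Prod.fst ⁻¹' {i | w ∈ K.verts i} ∪ {p | p.2 w = 0}) := by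
    ext p
    simp [or_iff_not_imp_left]
  have hcl : IsClosed {p : Fin m × (Fin k → ℝ) | p.2 ∈ stdSimplex ℝ (Fin k) ∧
      ∀ w, w ∉ K.verts p.1 → p.2 w = 0} := by
    rw [h]
    refine ((isClosed_stdSimplex ℝ (Fin k)).preimage continuous_snd).inter
      (isClosed_iInter fun w => ((isClosed_discrete _).preimage continuous_fst).union ?_)
    exact isClosed_eq ((continuous_apply w).comp continuous_snd) continuous_const
  exact isCompact_iff_compactSpace.1 <| (isCompact_univ.prod
    (isCompact_stdSimplex ℝ (Fin k))).of_isClosed_subset hcl fun p hp => ⟨trivial, hp.1⟩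

/-- The map descends to a continuous injection of a compact space into a Hausdorff one, hence an
embedding, and a compact convex body is homeomorphic to the unit ball. -/
theorem ofVerts_isBall {m k : ℕ} {verts : Fin m → Finset (Fin k)} {hc : ∀ i, (verts i).card = 4}
    {hinj : Function.Injective verts} {f : (Fin k → ℝ) → EuclideanSpace ℝ (Fin 3)}
    (hf : Continuous f) (hfi : Set.InjOn f (carrier verts)) {Q : Set (EuclideanSpace ℝ (Fin 3))}
    (himg : f '' carrier verts = Q) (hQ : Convex ℝ Q) (hQi : (interior Q).Nonempty)
    (hQb : Bornology.IsBounded Q) : (ofVerts verts hc hinj).IsBall := by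
  set K := ofVerts verts hc hinj
  have hmem : ∀ p : K.Point, p.1.2 ∈ carrier verts := fun p => ⟨p.2.1, p.1.1, p.2.2⟩
  let F : K.Realization → EuclideanSpace ℝ (Fin 3) :=
    Quotient.lift (fun p : K.Point => f p.1.2) fun p q h => congrArg f h.1
  have hF : Continuous F :=
    Continuous.quotient_lift (hf.comp (continuous_snd.comp continuous_subtype_val)) _
  have hFi : Function.Injective F := by
    intro a b
    induction a using Quotient.inductionOn with | _ p =>
    induction b using Quotient.inductionOn with | _ q =>
    intro h
    have hpq : p.1.2 = q.1.2 := hfi (hmem p) (hmem q) h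
    -- In a simplicial complex, points with equal coordinates are glued along the common face of
    -- their tetrahedra.
    refine Quotient.sound ⟨hpq, verts p.1.1 ∩ verts q.1.1,
      ⟨Finset.inter_subset_left, Finset.inter_subset_right⟩, fun w hw => ?_⟩
    by_cases hwp : w ∈ verts p.1.1
    · rw [hpq]
      exact q.2.2 w fun hwq => hw (Finset.mem_inter.2 ⟨hwp, hwq⟩)
    · exact p.2.2 w hwp
  have hrange : Set.range F = Q := by
    rw [← himg]
    ext P
    constructor
    · rintro ⟨a, rfl⟩
      induction a using Quotient.inductionOn with | _ p =>
      exact ⟨_, hmem p, rfl⟩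
    · rintro ⟨p, ⟨hp, i, hi⟩, rfl⟩
      exact ⟨Quotient.mk _ ⟨(i, p), hp, hi⟩, rfl⟩
  have hcl : IsClosed Q := hrange ▸ (isCompact_range hF).isClosed
  obtain ⟨e, -, he, -⟩ := exists_homeomorph_image_interior_closure_frontier_eq_unitBall hQ hQi hQb
  rw [hcl.closure_eq] at he
  exact ⟨(hF.isClosedEmbedding hFi).isEmbedding.toHomeomorph.trans <|
    (Homeomorph.setCongr hrange).trans <| (e.image Q).trans (Homeomorph.setCongr he)⟩

end TetComplex

/-- A convex body in space that is bounded by two piecewise linear graphs. -/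
def wedgeBody : Set (EuclideanSpace ℝ (Fin 3)) :=
  {P | |P 0| + 2 * |P 1| - 3 / 2 ≤ P 2 ∧ P 2 ≤ 3 / 2 - |P 1| - 2 * |P 0|}

lemma convex_wedgeBody : Convex ℝ wedgeBody := by
  intro P hP R hR a b ha hb hab
  have h : ∀ i, |a * P i + b * R i| ≤ a * |P i| + b * |R i| := fun i => by
    refine (abs_add_le _ _).trans ?_
    rw [abs_mul, abs_mul, abs_of_nonneg ha, abs_of_nonneg hb]
  have h0 := h 0
  have h1 := h 1
  simp only [wedgeBody, Set.mem_ofPred_eq, PiLp.add_apply, PiLp.smul_apply, smul_eq_mul] at hP hR ⊢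
  have e1 := mul_le_mul_of_nonneg_left hP.1 ha
  have e2 := mul_le_mul_of_nonneg_left hP.2 ha
  have e3 := mul_le_mul_of_nonneg_left hR.1 hb
  have e4 := mul_le_mul_of_nonneg_left hR.2 hb
  constructor <;> nlinarith

lemma interior_wedgeBody_nonempty : (interior wedgeBody).Nonempty := by
  refine ⟨0, mem_interior.2 ⟨{P | |P 0| + 2 * |P 1| - 3 / 2 < P 2 ∧
    P 2 < 3 / 2 - |P 1| - 2 * |P 0|}, fun P hP => ⟨hP.1.le, hP.2.le⟩, ?_, by simp⟩⟩
  have h₁ : IsOpen {P : EuclideanSpace ℝ (Fin 3) | |P 0| + 2 * |P 1| - 3 / 2 < P 2} :=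
    isOpen_lt (by fun_prop) (by fun_prop)
  have h₂ : IsOpen {P : EuclideanSpace ℝ (Fin 3) | P 2 < 3 / 2 - |P 1| - 2 * |P 0|} :=
    isOpen_lt (by fun_prop) (by fun_prop)
  exact h₁.inter h₂

lemma isBounded_wedgeBody : Bornology.IsBounded wedgeBody := by
  refine (Metric.isBounded_closedBall (x := 0) (r := 3)).subset fun P hP => ?_
  obtain ⟨h1, h2⟩ := hP
  have a0 := abs_nonneg (P 0)
  have a1 := abs_nonneg (P 1)
  have hz : |P 2| ≤ 3 / 2 := abs_le.2 ⟨by linarith, by linarith⟩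
  rw [mem_closedBall_zero_iff, EuclideanSpace.norm_eq, Real.sqrt_le_left (by norm_num)]
  simp only [Fin.sum_univ_three, Real.norm_eq_abs]
  have h0 : |P 0| ≤ 1 := by linarith
  have h1 : |P 1| ≤ 1 := by linarith
  nlinarith [abs_nonneg (P 2)]

/-! ### Weights on the vertices of a path -/

section PathWeights
variable {n : ℕ}

/-- The weights are concentrated on an edge of the path `0, …, n + 1`. -/
def OnPath (σ : Fin (n + 2) → ℝ) : Prop :=
  ∃ i : Fin (n + 1), ∀ j, j ≠ i.castSucc → j ≠ i.succ → σ j = 0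

/-- The weights are concentrated on the ends of the path `0, …, n + 1`. -/
def OnEnds (σ : Fin (n + 2) → ℝ) : Prop :=
  ∀ j, j ≠ 0 → j ≠ Fin.last (n + 1) → σ j = 0

noncomputable def total (σ : Fin (n + 2) → ℝ) : ℝ := ∑ j, σ j

/-- The weighted sum of the positions of the vertices, where the path runs from `1` to `-1`. -/
noncomputable def moment (σ : Fin (n + 2) → ℝ) : ℝ := ∑ j : Fin (n + 2), (1 - 2 * j / (n + 1)) * σ j

/-- This correction term is 0 on path edges (for n ≥ 1) and half of `total - |moment|` on the ends,
so the single continuous formula `height` gives a different expression in each situation. -/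
noncomputable def minEnds (σ : Fin (n + 2) → ℝ) : ℝ := min (σ 0) (σ (Fin.last (n + 1)))

lemma sum_onPath {σ : Fin (n + 2) → ℝ} {i : Fin (n + 1)}
    (h : ∀ j, j ≠ i.castSucc → j ≠ i.succ → σ j = 0) (c : Fin (n + 2) → ℝ) :
    ∑ j, c j * σ j = c i.castSucc * σ i.castSucc + c i.succ * σ i.succ :=
  Fintype.sum_eq_add _ _ (Fin.castSucc_lt_succ).ne fun j hj => by rw [h j hj.1 hj.2, mul_zero]

lemma sum_onEnds {σ : Fin (n + 2) → ℝ} (h : OnEnds σ) (c : Fin (n + 2) → ℝ) :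
    ∑ j, c j * σ j = c 0 * σ 0 + c (Fin.last _) * σ (Fin.last _) :=
  Fintype.sum_eq_add _ _ (Fin.last_pos).ne fun j hj => by rw [h j hj.1 hj.2, mul_zero]

lemma total_eq (σ : Fin (n + 2) → ℝ) : total σ = ∑ j, (1 : ℝ) * σ j := by simp [total]

lemma OnEnds.total_eq {σ : Fin (n + 2) → ℝ} (h : OnEnds σ) :
    total σ = σ 0 + σ (Fin.last _) := by
  rw [_root_.total_eq, sum_onEnds h]; ring

lemma OnEnds.moment_eq {σ : Fin (n + 2) → ℝ} (h : OnEnds σ) :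
    moment σ = σ 0 - σ (Fin.last _) := by
  rw [moment, sum_onEnds h]
  have : (n + 1 : ℝ) ≠ 0 := by positivity
  simp
  field_simp
  ring

lemma abs_moment_le {σ : Fin (n + 2) → ℝ} (h0 : ∀ j, 0 ≤ σ j) : |moment σ| ≤ total σ := by
  refine (Finset.abs_sum_le_sum_abs _ _).trans (Finset.sum_le_sum fun j _ => ?_)
  rw [abs_mul, abs_of_nonneg (h0 j)]
  refine mul_le_of_le_one_left (h0 j) ?_
  have h1 : (j : ℝ) ≤ n + 1 := by exact_mod_cast Nat.lt_succ_iff.1 j.2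
  have h2 : (j : ℝ) / (n + 1) ≤ 1 := div_le_one_of_le₀ h1 (by positivity)
  have h3 : 0 ≤ (j : ℝ) / (n + 1) := by positivity
  rw [mul_div_assoc, abs_le]
  constructor <;> linarith

lemma OnEnds.total_sub_abs {σ : Fin (n + 2) → ℝ} (h : OnEnds σ) :
    total σ - |moment σ| = 2 * minEnds σ := by
  rw [h.total_eq, h.moment_eq, minEnds]
  rcases le_total (σ 0) (σ (Fin.last _)) with h | h
  · rw [min_eq_left h, abs_of_nonpos (by linarith)]; ring
  · rw [min_eq_right h, abs_of_nonneg (by linarith)]; ring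

lemma OnPath.minEnds_eq (hn : 1 ≤ n) {σ : Fin (n + 2) → ℝ} (h0 : ∀ j, 0 ≤ σ j) (h : OnPath σ) :
    minEnds σ = 0 := by
  obtain ⟨i, hi⟩ := h
  have key : σ 0 = 0 ∨ σ (Fin.last _) = 0 := by
    have hne : ∀ a b : Fin (n + 2), (a : ℕ) ≠ b → a ≠ b := fun a b h h' => h (congrArg _ h')
    by_cases h : (i : ℕ) = 0
    · refine Or.inr (hi _ (hne _ _ ?_) (hne _ _ ?_)) <;>
        simp only [Fin.val_last, Fin.val_castSucc, Fin.val_succ] <;> omega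
    · refine Or.inl (hi _ (hne _ _ ?_) (hne _ _ ?_)) <;>
        simp only [Fin.val_zero, Fin.val_castSucc, Fin.val_succ] <;> omega
  rcases key with h | h
  · rw [minEnds, h, min_eq_left (h0 _)]
  · rw [minEnds, h, min_eq_right (h0 _)]

/-- Positions lie in [-1, 1], and strictly inside for inner vertices, so an extremal moment leaves
no weight there. This identifies the points on the interfaces between the layers. -/
lemma onEnds_of_total_eq_abs {σ : Fin (n + 2) → ℝ} (h0 : ∀ j, 0 ≤ σ j)
    (h : total σ = |moment σ|) : OnEnds σ := by
  have hn : (0 : ℝ) < n + 1 := by positivity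
  have main : ∀ c : Fin (n + 2) → ℝ, (∀ j, 0 ≤ c j) → ∑ j, c j * σ j = 0 →
      ∀ j, c j ≠ 0 → σ j = 0 := fun c hc hs j hj =>
    (mul_eq_zero.1 ((Finset.sum_eq_zero_iff_of_nonneg fun j _ => mul_nonneg (hc j) (h0 j)).1 hs j
      (Finset.mem_univ j))).resolve_left hj
  have hle : ∀ j : Fin (n + 2), (j : ℝ) ≤ n + 1 := fun j => by
    exact_mod_cast Nat.lt_succ_iff.1 j.2
  intro j hj0 hjl
  have hj0' : (j : ℝ) ≠ 0 := fun h => hj0 (by exact_mod_cast h)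
  have hjl' : (j : ℝ) ≠ n + 1 := fun h => hjl (Fin.ext (by exact_mod_cast h))
  rcases abs_choice (moment σ) with ha | ha
  -- The coefficient is 1 minus the position; in the other case it is 1 plus the position.
  · refine main (fun j => 2 * j / (n + 1)) (fun j => by positivity) ?_ j (by positivity)
    have : total σ - moment σ = 0 := by rw [h, ha]; ring
    rw [total, moment, ← Finset.sum_sub_distrib] at this
    rw [← this]
    exact Finset.sum_congr rfl fun j _ => by ring
  · refine main (fun j => 2 - 2 * j / (n + 1)) (fun j => ?_) ?_ j ?_
    · rw [sub_nonneg, div_le_iff₀ hn]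
      linarith [hle j]
    · have : total σ + moment σ = 0 := by rw [h, ha]; ring
      rw [total, moment, ← Finset.sum_add_distrib] at this
      rw [← this]
      exact Finset.sum_congr rfl fun j _ => by ring
    · intro h
      apply hjl'
      field_simp at h
      linarith

lemma OnEnds.ext {σ ρ : Fin (n + 2) → ℝ} (hσ : OnEnds σ) (hρ : OnEnds ρ)
    (ht : total σ = total ρ) (hm : moment σ = moment ρ) : σ = ρ := by
  rw [hσ.total_eq, hρ.total_eq] at ht
  rw [hσ.moment_eq, hρ.moment_eq] at hm
  funext j
  by_cases h0 : j = 0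
  · rw [h0]; linarith
  by_cases h1 : j = Fin.last _
  · rw [h1]; linarith
  rw [hσ j h0 h1, hρ j h0 h1]

/-- If the edge of σ is to the left of the edge of ρ, test both against `j - (i + 1)`, which
vanishes at the right end of the left edge. The sums are equal, one is ≤ 0 and the other ≥ 0, so
both vanish. -/
lemma OnPath.ext {σ ρ : Fin (n + 2) → ℝ} (hσ0 : ∀ j, 0 ≤ σ j) (hρ0 : ∀ j, 0 ≤ ρ j)
    (hσ : OnPath σ) (hρ : OnPath ρ)
    (ht : total σ = total ρ) (hm : moment σ = moment ρ) : σ = ρ := by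
  obtain ⟨i, hi⟩ := hσ
  obtain ⟨l, hl⟩ := hρ
  wlog hil : i ≤ l generalizing σ ρ i l
  · exact (this hρ0 hσ0 ht.symm hm.symm l hl i hi (le_of_not_ge hil)).symm
  have hn : (n + 1 : ℝ) ≠ 0 := by positivity
  have hS : ∀ τ : Fin (n + 2) → ℝ, ∑ j : Fin (n + 2), (j - (i + 1) : ℝ) * τ j =
      (n + 1) / 2 * (total τ - moment τ) - (i + 1) * total τ := by
    intro τ
    rw [total, moment, ← Finset.sum_sub_distrib, Finset.mul_sum, Finset.mul_sum,
      ← Finset.sum_sub_distrib]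
    exact Finset.sum_congr rfl fun j _ => by field_simp; ring
  have heq := (hS σ).trans ((by rw [ht, hm] : _ = _).trans (hS ρ).symm)
  rw [sum_onPath hi, sum_onPath hl] at heq
  rw [_root_.total_eq, _root_.total_eq, sum_onPath hi, sum_onPath hl] at ht
  simp only [Fin.val_castSucc, Fin.val_succ, Nat.cast_add, Nat.cast_one] at heq ht
  have e1 := hσ0 i.castSucc
  have e2 := hρ0 l.castSucc
  have e3 := hρ0 l.succ
  rcases hil.eq_or_lt with rfl | hlt
  · have h1 : σ i.castSucc = ρ i.castSucc := by linarith
    have h2 : σ i.succ = ρ i.succ := by linarith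
    funext j
    by_cases hj : j = i.castSucc
    · rw [hj, h1]
    by_cases hj' : j = i.succ
    · rw [hj', h2]
    rw [hi j hj hj', hl j hj hj']
  · have hlt' : (i : ℝ) + 1 ≤ l := by exact_mod_cast Fin.lt_def.1 hlt
    have p1 : 0 ≤ ((l : ℝ) - (i + 1)) * ρ l.castSucc := mul_nonneg (by linarith) e2
    have p2 : 0 ≤ ((l : ℝ) - (i + 1)) * ρ l.succ := mul_nonneg (by linarith) e3
    have h1 : σ i.castSucc = 0 := by linarith
    have h2 : ρ l.succ = 0 := by linarith
    have h3 : ((l : ℝ) - (i + 1)) * ρ l.castSucc = 0 := by linarith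
    rw [h1, h2] at ht
    have hne : i.castSucc ≠ i.succ := (Fin.castSucc_lt_succ).ne
    have hs : ∀ j, j ≠ i.succ → σ j = 0 := fun j hj => by
      by_cases hj' : j = i.castSucc
      · rw [hj', h1]
      · exact hi j hj' hj
    have hr : ∀ j, j ≠ l.castSucc → ρ j = 0 := fun j hj => by
      by_cases hj' : j = l.succ
      · rw [hj', h2]
      · exact hl j hj hj'
    rcases mul_eq_zero.1 h3 with h | h
    · have : l.castSucc = i.succ := by
        have h' : (l : ℝ) = (i : ℝ) + 1 := by linarith
        have : (l : ℕ) = i + 1 := by exact_mod_cast h'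
        simp [Fin.ext_iff, this]
      rw [this] at ht hr
      funext j
      by_cases hj : j = i.succ
      · rw [hj]; linarith
      · rw [hs j hj, hr j hj]
    · have h5 : σ i.succ = 0 := by rw [h] at ht; linarith
      funext j
      by_cases hj : j = i.succ <;> by_cases hj' : j = l.castSucc <;> simp_all

lemma exists_onEnds {r d : ℝ} (h : |d| ≤ r) : ∃ σ : Fin (n + 2) → ℝ,
    (∀ j, 0 ≤ σ j) ∧ OnEnds σ ∧ total σ = r ∧ moment σ = d := by
  obtain ⟨h1, h2⟩ := abs_le.1 h
  let σ : Fin (n + 2) → ℝ := fun j => if j = 0 then (r + d) / 2 else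
    if j = Fin.last _ then (r - d) / 2 else 0
  have hσ : OnEnds σ := fun j h h' => by simp [σ, h, h']
  refine ⟨σ, fun j => ?_, hσ, ?_, ?_⟩
  · simp only [σ]
    split_ifs <;> linarith
  · rw [hσ.total_eq]; simp [σ]; ring
  · rw [hσ.moment_eq]; simp [σ]; ring

/-- Division with remainder without dividing, so that `r = 0` needs no separate case. -/
lemma exists_mul_le_le_mul {r c : ℝ} (hc : 0 ≤ c) (N : ℕ) (h : c ≤ (N + 1) * r) :
    ∃ i : ℕ, i ≤ N ∧ i * r ≤ c ∧ c ≤ (i + 1) * r := by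
  induction N with
  | zero => exact ⟨0, le_rfl, by simpa using hc, by simpa using h⟩
  | succ N ih =>
    by_cases h' : c ≤ (N + 1) * r
    · obtain ⟨i, hi, h⟩ := ih h'
      exact ⟨i, by omega, h⟩
    · exact ⟨N + 1, le_rfl, by push_cast; linarith, h⟩

lemma exists_onPath {r d : ℝ} (h : |d| ≤ r) : ∃ σ : Fin (n + 2) → ℝ,
    (∀ j, 0 ≤ σ j) ∧ OnPath σ ∧ total σ = r ∧ moment σ = d := by
  obtain ⟨h1, h2⟩ := abs_le.1 h
  have hn : (0 : ℝ) < n + 1 := by positivity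
  -- The number `c` is the required value of `∑ j, j * σ j`; it selects the edge and then the
  -- weights on it.
  obtain ⟨i, hi, h3, h4⟩ := exists_mul_le_le_mul (r := r) (c := (n + 1) * (r - d) / 2)
    (by have := mul_nonneg hn.le (sub_nonneg.2 h2); linarith) n (by nlinarith)
  set c := (n + 1) * (r - d) / 2 with hcdef
  let I : Fin (n + 1) := ⟨i, by omega⟩
  have hne : I.succ ≠ I.castSucc := (Fin.castSucc_lt_succ).ne'
  let σ : Fin (n + 2) → ℝ := fun j => if j = I.castSucc then (i + 1) * r - c else
    if j = I.succ then c - i * r else 0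
  have hσ : ∀ j, j ≠ I.castSucc → j ≠ I.succ → σ j = 0 := fun j h h' => by simp [σ, h, h']
  refine ⟨σ, fun j => ?_, ⟨I, hσ⟩, ?_, ?_⟩
  · simp only [σ]
    split_ifs <;> linarith
  · rw [_root_.total_eq, sum_onPath hσ]
    simp [σ, hne]
    ring
  · rw [moment, sum_onPath hσ]
    simp only [σ, hne, if_true, if_false, I, Fin.val_castSucc, Fin.val_succ, Nat.cast_add,
      Nat.cast_one, hcdef]
    field_simp
    ring

/-- The height of a point of the join of two paths is `height s - height t`. -/
noncomputable def height (σ : Fin (n + 2) → ℝ) : ℝ := 3 / 2 * total σ - 2 * |moment σ| - 4 * minEnds σ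

lemma OnEnds.height_eq {σ : Fin (n + 2) → ℝ} (h : OnEnds σ) : height σ = -(total σ) / 2 := by
  have := h.total_sub_abs
  rw [height]; linarith

lemma OnPath.height_eq (hn : 1 ≤ n) {σ : Fin (n + 2) → ℝ} (h0 : ∀ j, 0 ≤ σ j) (h : OnPath σ) :
    height σ = 3 / 2 * total σ - 2 * |moment σ| := by
  rw [height, h.minEnds_eq hn h0]; ring

/-- The points of the complex, given by their weights `s` and `t` on the two paths. -/
structure IsJoinPoint (s t : Fin (n + 2) → ℝ) : Prop where
  nonneg_left : ∀ j, 0 ≤ s j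
  nonneg_right : ∀ j, 0 ≤ t j
  total_add : total s + total t = 1
  cases : OnPath s ∧ OnEnds t ∨ OnEnds s ∧ OnEnds t ∨ OnEnds s ∧ OnPath t

/-- With x, y the moments and S, T the totals, z is S + 1/2 - 2|x|, 1/2 - S or -1/2 - T + 2|y| in
the three cases, so z determines the totals. Since |x| ≤ S and |y| ≤ T, the cases fill z ≥ 1/2 -
|x|, the layer between, and z ≤ |y| - 1/2; points of different cases can agree only on an interface,
where all weights are on ends. -/
lemma IsJoinPoint.ext (hn : 1 ≤ n) {s t s' t' : Fin (n + 2) → ℝ} (h : IsJoinPoint s t)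
    (h' : IsJoinPoint s' t') (hx : moment s = moment s') (hy : moment t = moment t')
    (hz : height s - height t = height s' - height t') : s = s' ∧ t = t' := by
  obtain ⟨hs, ht, h1, hc⟩ := h
  obtain ⟨hs', ht', h1', hc'⟩ := h'
  have ms := abs_moment_le hs
  have mt := abs_moment_le ht
  have ms' := abs_moment_le hs'
  have mt' := abs_moment_le ht'
  have fin : total s = total s' → OnEnds s → OnEnds s' → OnEnds t → OnEnds t' → s = s' ∧ t = t' :=
    fun h a a' b b' => ⟨a.ext a' h hx, b.ext b' (by linarith) hy⟩
  rw [← hx] at ms'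
  rw [← hy] at mt'
  rcases hc with ⟨a, b⟩ | ⟨a, b⟩ | ⟨a, b⟩ <;> rcases hc' with ⟨a', b'⟩ | ⟨a', b'⟩ | ⟨a', b'⟩
  · rw [a.height_eq hn hs, b.height_eq, a'.height_eq hn hs', b'.height_eq, ← hx] at hz
    exact ⟨a.ext hs hs' a' (by linarith) hx, b.ext b' (by linarith) hy⟩
  · rw [a.height_eq hn hs, b.height_eq, a'.height_eq, b'.height_eq] at hz
    exact fin (by linarith) (onEnds_of_total_eq_abs hs (by linarith)) a' b b'
  · rw [a.height_eq hn hs, b.height_eq, a'.height_eq, b'.height_eq hn ht', ← hy] at hz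
    exact fin (by linarith) (onEnds_of_total_eq_abs hs (by linarith)) a' b
      (onEnds_of_total_eq_abs ht' (by rw [← hy]; linarith))
  · rw [a.height_eq, b.height_eq, a'.height_eq hn hs', b'.height_eq, ← hx] at hz
    exact fin (by linarith) a (onEnds_of_total_eq_abs hs' (by rw [← hx]; linarith)) b b'
  · rw [a.height_eq, b.height_eq, a'.height_eq, b'.height_eq] at hz
    exact fin (by linarith) a a' b b'
  · rw [a.height_eq, b.height_eq, a'.height_eq, b'.height_eq hn ht', ← hy] at hz
    exact fin (by linarith) a a' b (onEnds_of_total_eq_abs ht' (by rw [← hy]; linarith))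
  · rw [a.height_eq, b.height_eq hn ht, a'.height_eq hn hs', b'.height_eq, ← hx] at hz
    exact fin (by linarith) a (onEnds_of_total_eq_abs hs' (by rw [← hx]; linarith))
      (onEnds_of_total_eq_abs ht (by linarith)) b'
  · rw [a.height_eq, b.height_eq hn ht, a'.height_eq, b'.height_eq] at hz
    exact fin (by linarith) a a' (onEnds_of_total_eq_abs ht (by linarith)) b'
  · rw [a.height_eq, b.height_eq hn ht, a'.height_eq, b'.height_eq hn ht', ← hy] at hz
    exact ⟨a.ext a' (by linarith) hx, b.ext ht ht' b' (by linarith) hy⟩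

lemma IsJoinPoint.height_bounds (hn : 1 ≤ n) {s t : Fin (n + 2) → ℝ} (h : IsJoinPoint s t) :
    |moment s| + 2 * |moment t| - 3 / 2 ≤ height s - height t ∧
      height s - height t ≤ 3 / 2 - |moment t| - 2 * |moment s| := by
  obtain ⟨hs, ht, h1, hc⟩ := h
  have ms := abs_moment_le hs
  have mt := abs_moment_le ht
  rcases hc with ⟨a, b⟩ | ⟨a, b⟩ | ⟨a, b⟩
  · rw [a.height_eq hn hs, b.height_eq]
    constructor <;> linarith
  · rw [a.height_eq, b.height_eq]
    constructor <;> linarith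
  · rw [a.height_eq, b.height_eq hn ht]
    constructor <;> linarith

/-- The planes of height 1/2 - |x| and |y| - 1/2 decide the layer; solving its formula for z gives
the total weights, and the bounds on z are exactly what makes them admissible. -/
lemma exists_isJoinPoint (hn : 1 ≤ n) {x y z : ℝ} (h₁ : |x| + 2 * |y| - 3 / 2 ≤ z)
    (h₂ : z ≤ 3 / 2 - |y| - 2 * |x|) : ∃ s t : Fin (n + 2) → ℝ, IsJoinPoint s t ∧
      moment s = x ∧ moment t = y ∧ height s - height t = z := by
  by_cases hU : 1 / 2 - |x| ≤ z
  · obtain ⟨s, hs, a, ts, rfl⟩ := exists_onPath (n := n) (r := z - 1 / 2 + 2 * |x|) (d := x)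
      (by linarith)
    obtain ⟨t, ht, b, tt, rfl⟩ := exists_onEnds (n := n)
      (r := 1 - (z - 1 / 2 + 2 * |moment s|)) (d := y) (by linarith)
    refine ⟨s, t, ⟨hs, ht, by linarith, Or.inl ⟨a, b⟩⟩, rfl, rfl, ?_⟩
    rw [a.height_eq hn hs, b.height_eq]
    linarith
  by_cases hV : z ≤ -1 / 2 + |y|
  · obtain ⟨t, ht, b, tt, rfl⟩ := exists_onPath (n := n) (r := -1 / 2 - z + 2 * |y|) (d := y)
      (by linarith)
    obtain ⟨s, hs, a, ts, rfl⟩ := exists_onEnds (n := n)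
      (r := 1 - (-1 / 2 - z + 2 * |moment t|)) (d := x) (by linarith)
    refine ⟨s, t, ⟨hs, ht, by linarith, Or.inr (Or.inr ⟨a, b⟩)⟩, rfl, rfl, ?_⟩
    rw [a.height_eq, b.height_eq hn ht]
    linarith
  · obtain ⟨s, hs, a, ts, rfl⟩ := exists_onEnds (n := n) (r := 1 / 2 - z) (d := x) (by linarith)
    obtain ⟨t, ht, b, tt, rfl⟩ := exists_onEnds (n := n) (r := 1 / 2 + z) (d := y) (by linarith)
    refine ⟨s, t, ⟨hs, ht, by linarith, Or.inr (Or.inl ⟨a, b⟩)⟩, rfl, rfl, ?_⟩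
    rw [a.height_eq, b.height_eq]
    linarith

end PathWeights

/-! ### The decomposition with 2n + 3 tetrahedra -/

section Decomposition
variable {n : ℕ}

/-- `w` is a vertex of the tetrahedron `i` of the decomposition of `τₙ`: one tetrahedron for every
edge of each of the two paths, and one in the centre. -/
def IsJoinVertex (n i w : ℕ) : Prop :=
  (i ≤ n ∧ (w = i ∨ w = i + 1 ∨ w = n + 2 ∨ w = 2 * n + 3)) ∨
  (i = n + 1 ∧ (w = 0 ∨ w = n + 1 ∨ w = n + 2 ∨ w = 2 * n + 3)) ∨
  (n + 2 ≤ i ∧ (w = 0 ∨ w = n + 1 ∨ w = i ∨ w = i + 1))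

instance (n i w : ℕ) : Decidable (IsJoinVertex n i w) := by
  unfold IsJoinVertex
  infer_instance

/-- Tetrahedron `i` always contains `i` and `i + 1`: this is an edge of L or U, except for `i = n +
1`, where it is AC and the tetrahedron is ABCD. -/
def joinVerts (n : ℕ) (i : Fin (2 * n + 3)) : Finset (Fin (2 * n + 4)) :=
  Finset.univ.filter fun w => IsJoinVertex n i w

lemma mem_joinVerts {i : Fin (2 * n + 3)} {w : Fin (2 * n + 4)} :
    w ∈ joinVerts n i ↔ IsJoinVertex n i w := by
  simp [joinVerts]

lemma joinVerts_eq (i : Fin (2 * n + 3)) : ∃ a b c d : Fin (2 * n + 4),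
    (a : ℕ) < b ∧ (b : ℕ) < c ∧ (c : ℕ) < d ∧ joinVerts n i = {a, b, c, d} ∧
    (((i : ℕ) ≤ n ∧ (a : ℕ) = i ∧ (b : ℕ) = i + 1 ∧ (c : ℕ) = n + 2 ∧ (d : ℕ) = 2 * n + 3) ∨
    ((i : ℕ) = n + 1 ∧ (a : ℕ) = 0 ∧ (b : ℕ) = n + 1 ∧ (c : ℕ) = n + 2 ∧ (d : ℕ) = 2 * n + 3) ∨
    (n + 2 ≤ (i : ℕ) ∧ (a : ℕ) = 0 ∧ (b : ℕ) = n + 1 ∧ (c : ℕ) = i ∧ (d : ℕ) = i + 1)) := by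
  obtain ⟨i, hi⟩ := i
  have main : ∀ a b c d : ℕ, a < b → b < c → c < d → d < 2 * n + 4 →
      ((i ≤ n ∧ a = i ∧ b = i + 1 ∧ c = n + 2 ∧ d = 2 * n + 3) ∨
      (i = n + 1 ∧ a = 0 ∧ b = n + 1 ∧ c = n + 2 ∧ d = 2 * n + 3) ∨
      (n + 2 ≤ i ∧ a = 0 ∧ b = n + 1 ∧ c = i ∧ d = i + 1)) →
      ∃ a' b' c' d' : Fin (2 * n + 4), (a' : ℕ) = a ∧ (b' : ℕ) = b ∧ (c' : ℕ) = c ∧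
        (d' : ℕ) = d ∧ joinVerts n ⟨i, hi⟩ = {a', b', c', d'} := by
    intro a b c d hab hbc hcd hd h
    refine ⟨⟨a, by omega⟩, ⟨b, by omega⟩, ⟨c, by omega⟩, ⟨d, hd⟩, rfl, rfl, rfl, rfl, ?_⟩
    ext w
    simp only [mem_joinVerts, Finset.mem_insert, Finset.mem_singleton, Fin.ext_iff]
    unfold IsJoinVertex
    omega
  obtain ⟨a, b, c, d, hab, hbc, hcd, hd, h⟩ : ∃ a b c d : ℕ, a < b ∧ b < c ∧ c < d ∧
      d < 2 * n + 4 ∧ ((i ≤ n ∧ a = i ∧ b = i + 1 ∧ c = n + 2 ∧ d = 2 * n + 3) ∨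
      (i = n + 1 ∧ a = 0 ∧ b = n + 1 ∧ c = n + 2 ∧ d = 2 * n + 3) ∨
      (n + 2 ≤ i ∧ a = 0 ∧ b = n + 1 ∧ c = i ∧ d = i + 1)) := by
    by_cases h1 : i ≤ n
    · exact ⟨i, i + 1, n + 2, 2 * n + 3, by omega⟩
    by_cases h2 : i = n + 1
    · exact ⟨0, n + 1, n + 2, 2 * n + 3, by omega⟩
    · exact ⟨0, n + 1, i, i + 1, by omega⟩
  obtain ⟨a', b', c', d', rfl, rfl, rfl, rfl, hv⟩ := main a b c d hab hbc hcd hd h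
  exact ⟨a', b', c', d', hab, hbc, hcd, hv, h⟩

lemma card_joinVerts (i : Fin (2 * n + 3)) : (joinVerts n i).card = 4 := by
  obtain ⟨a, b, c, d, hab, hbc, hcd, h, -⟩ := joinVerts_eq i
  rw [h, Finset.card_insert_of_notMem, Finset.card_insert_of_notMem, Finset.card_pair]
  all_goals simp only [Finset.mem_insert, Finset.mem_singleton, Fin.ext_iff, ne_eq]; omega

/-- The base of a triangle of `τₙ` lies in one tetrahedron only. -/
lemma eq_of_isApexBase (hn : 2 ≤ n) {w p : Fin (2 * n + 4)} {i : Fin (2 * n + 3)}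
    (h : IsApexBase n w p (p + 1)) (hp : p ∈ joinVerts n i) (hq : IsJoinVertex n i (p + 1)) :
    (i : ℕ) = p := by
  rw [mem_joinVerts] at hp
  simp only [IsApexBase, IsJoinVertex] at *
  omega

lemma exists_apexBase {t : Finset (Fin (2 * n + 4))} (ht : t ∈ tau n) :
    ∃ w p q : Fin (2 * n + 4), t = {w, p, q} ∧ (q : ℕ) = p + 1 ∧ IsApexBase n w p (p + 1) := by
  obtain ⟨a, b, c, -, -, -, rfl⟩ := Finset.card_eq_three.1 (card_of_mem_tau ht)
  have key : ∀ w p q : Fin (2 * n + 4), IsApexBase n w p q → ∃ p' q' : Fin (2 * n + 4),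
      ({w, p, q} : Finset _) = {w, p', q'} ∧ (q' : ℕ) = p' + 1 ∧ IsApexBase n w p' (p' + 1) := by
    intro w p q h
    rcases h.1 with h1 | h1
    · exact ⟨p, q, rfl, h1.symm, h1 ▸ h⟩
    · exact ⟨q, p, by rw [Finset.pair_comm], h1.symm, by rw [h1]; exact isApexBase_comm.1 h⟩
  rcases mem_tau_iff.1 ht with h | h | h
  · exact ⟨a, key a b c h⟩
  · rw [Finset.insert_comm]
    exact ⟨b, key b a c h⟩
  · rw [Finset.pair_comm, Finset.insert_comm]
    exact ⟨c, key c a b h⟩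

/-- The triangle with base `{p, p + 1}` lies in tetrahedron `p` and in no other. -/
lemma exists_joinVerts_of_mem_tau (hn : 2 ≤ n) {t : Finset (Fin (2 * n + 4))} (ht : t ∈ tau n) :
    ∃ i, t ⊆ joinVerts n i ∧ ∀ j, t ⊆ joinVerts n j → j = i := by
  obtain ⟨w, p, q, rfl, hq, h⟩ := exists_apexBase ht
  have hlt := q.2
  refine ⟨⟨p, by omega⟩, ?_, fun j hj => Fin.ext ?_⟩
  · intro x hx
    simp only [Finset.mem_insert, Finset.mem_singleton, Fin.ext_iff] at hx
    rw [mem_joinVerts]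
    simp only [IsApexBase, IsJoinVertex] at *
    omega
  · refine eq_of_isApexBase hn h (hj (by simp)) ?_
    rw [← hq, ← mem_joinVerts]
    exact hj (by simp)

lemma joinVerts_injective (hn : 2 ≤ n) : Function.Injective (joinVerts n) := by
  intro i j hij
  have h : ∀ w, w < 2 * n + 4 → (IsJoinVertex n i w ↔ IsJoinVertex n j w) := fun w hw => by
    have := Finset.ext_iff.1 hij ⟨w, hw⟩
    rwa [mem_joinVerts, mem_joinVerts] at this
  have hi := i.2
  have hj := j.2
  have h1 := h i (by omega)
  have h2 := h (i + 1) (by omega)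
  have h3 := h j (by omega)
  have h4 := h (j + 1) (by omega)
  unfold IsJoinVertex at h1 h2 h3 h4
  rw [Fin.ext_iff]
  omega

/-- A face of a tetrahedron that lies in no other tetrahedron belongs to `τₙ`. -/
lemma mem_tau_of_unique {i : Fin (2 * n + 3)} {s : Finset (Fin (2 * n + 4))}
    (hs : s ⊆ joinVerts n i) (hc : s.card = 3) (hu : ∀ j, s ⊆ joinVerts n j → j = i) :
    s ∈ tau n := by
  obtain ⟨a, b, c, d, hab, hbc, hcd, h, hi⟩ := joinVerts_eq i
  have key : ∀ x y z : Fin (2 * n + 4), IsTauTriple n x y z ∨ (∃ j, j < 2 * n + 3 ∧ j ≠ (i : ℕ) ∧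
      IsJoinVertex n j x ∧ IsJoinVertex n j y ∧ IsJoinVertex n j z) → s = {x, y, z} →
      s ∈ tau n := by
    rintro x y z (h | ⟨j, hj, hji, hx, hy, hz⟩) rfl
    · exact mem_tau_iff.2 h
    · refine absurd (congrArg Fin.val (hu ⟨j, hj⟩ fun w hw => ?_)) hji
      rw [mem_joinVerts]
      simp only [Finset.mem_insert, Finset.mem_singleton] at hw
      rcases hw with rfl | rfl | rfl <;> assumption
  have hil := i.2
  have hcard : ({a, b, c} : Finset (Fin (2 * n + 4))).card = 3 :=
    Finset.card_eq_three.2 ⟨a, b, c, by simp only [ne_eq, Fin.ext_iff]; omega,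
      by simp only [ne_eq, Fin.ext_iff]; omega, by simp only [ne_eq, Fin.ext_iff]; omega, rfl⟩
  have hs4 : s = {a, b, c} ∨ s = {a, b, d} ∨ s = {a, c, d} ∨ s = {b, c, d} := by
    by_cases h' : s = {a, b, c}
    · exact Or.inl h'
    · exact Or.inr (eq_of_subset_of_ne hc hcard (h ▸ hs) h')
  rcases hi with ⟨hi, ha, hb, hc', hd⟩ | ⟨hi, ha, hb, hc', hd⟩ | ⟨hi, ha, hb, hc', hd⟩
  · rcases hs4 with hs | hs | hs | hs
    · exact key a b c (Or.inl (by unfold IsTauTriple IsApexBase; omega)) hs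
    · exact key a b d (Or.inl (by unfold IsTauTriple IsApexBase; omega)) hs
    -- Tetrahedra over L form a chain with ABCD closing it at both ends: the one before index `0` is
    -- `n + 1`, and the one after `n` is `n + 1` without a case split. The chain over U behaves
    -- likewise.
    · refine key a c d (Or.inr ⟨if (i : ℕ) = 0 then n + 1 else i - 1, ?_⟩) hs
      unfold IsJoinVertex
      split_ifs <;> omega
    · refine key b c d (Or.inr ⟨i + 1, ?_⟩) hs
      unfold IsJoinVertex
      omega
  · rcases hs4 with hs | hs | hs | hs
    · refine key a b c (Or.inr ⟨n + 2, ?_⟩) hs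
      unfold IsJoinVertex
      omega
    · refine key a b d (Or.inr ⟨2 * n + 2, ?_⟩) hs
      unfold IsJoinVertex
      omega
    · refine key a c d (Or.inr ⟨0, ?_⟩) hs
      unfold IsJoinVertex
      omega
    · refine key b c d (Or.inr ⟨n, ?_⟩) hs
      unfold IsJoinVertex
      omega
  · rcases hs4 with hs | hs | hs | hs
    · refine key a b c (Or.inr ⟨i - 1, ?_⟩) hs
      unfold IsJoinVertex
      omega
    · refine key a b d (Or.inr ⟨if (i : ℕ) = 2 * n + 2 then n + 1 else i + 1, ?_⟩) hs
      unfold IsJoinVertex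
      split_ifs <;> omega
    · exact key a c d (Or.inl (by unfold IsTauTriple IsApexBase; omega)) hs
    · exact key b c d (Or.inl (by unfold IsTauTriple IsApexBase; omega)) hs

/-- The decomposition of the ball into `2 n + 3` tetrahedra. -/
def joinComplex (hn : 2 ≤ n) : TetComplex (2 * n + 3) (2 * n + 4) :=
  TetComplex.ofVerts (joinVerts n) card_joinVerts (joinVerts_injective hn)

lemma joinComplex_hasBoundary (hn : 2 ≤ n) :
    (joinComplex hn).HasBoundary (Function.Embedding.refl _) (tau n) := by
  have hb : ∀ i s, (joinComplex hn).IsBoundaryFace i s ↔ s ⊆ joinVerts n i ∧ s.card = 3 ∧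
      ∀ j, s ⊆ joinVerts n j → j = i := by
    intro i s
    refine ⟨fun h => ⟨h.1, h.2.1, fun j hj => h.2.2 j ⟨h.1, hj⟩⟩,
      fun h => ⟨h.1, h.2.1, fun j hj => h.2.2 j hj.2⟩⟩
  simp only [TetComplex.HasBoundary, hb, Finset.map_refl]
  refine ⟨fun i s h => ⟨s, mem_tau_of_unique h.1 h.2.1 h.2.2, rfl⟩, fun t ht => ?_⟩
  obtain ⟨i, hi, hu⟩ := exists_joinVerts_of_mem_tau hn ht
  exact ⟨i, ⟨hi, card_of_mem_tau ht, hu⟩, fun j hj => hu j hj.1⟩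

/-- The weights on the path `0, …, n + 1`. -/
def lowerWeights (p : Fin (2 * n + 4) → ℝ) (j : Fin (n + 2)) : ℝ := p ⟨j, by omega⟩

/-- The weights on the path `n + 2, …, 2 n + 3`. -/
def upperWeights (p : Fin (2 * n + 4) → ℝ) (j : Fin (n + 2)) : ℝ := p ⟨n + 2 + j, by omega⟩

def joinWeights (s t : Fin (n + 2) → ℝ) (w : Fin (2 * n + 4)) : ℝ :=
  if h : (w : ℕ) < n + 2 then t ⟨w, h⟩ else s ⟨w - (n + 2), by omega⟩

lemma lowerWeights_joinWeights (s t : Fin (n + 2) → ℝ) : lowerWeights (joinWeights s t) = t := by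
  funext j
  simp [lowerWeights, joinWeights]

lemma upperWeights_joinWeights (s t : Fin (n + 2) → ℝ) : upperWeights (joinWeights s t) = s := by
  funext j
  simp [upperWeights, joinWeights]

lemma eq_of_weights_eq {p q : Fin (2 * n + 4) → ℝ} (h₁ : upperWeights p = upperWeights q)
    (h₂ : lowerWeights p = lowerWeights q) : p = q := by
  funext ⟨w, hw⟩
  by_cases h : w < n + 2
  · exact congrFun h₂ ⟨w, h⟩
  · have := congrFun h₁ ⟨w - (n + 2), by omega⟩
    simp only [upperWeights] at this
    have e : n + 2 + (w - (n + 2)) = w := by omega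
    simpa only [e] using this

lemma sum_eq_total_add (p : Fin (2 * n + 4) → ℝ) :
    ∑ w, p w = total (upperWeights p) + total (lowerWeights p) := by
  have h : (n + 2) + (n + 2) = 2 * n + 4 := by omega
  rw [← (finCongr h).sum_comp, Fin.sum_univ_add, add_comm]
  rfl

/-- The three kinds of tetrahedra match the three cases of `IsJoinPoint`, with `s` the weights on U
and `t` those on L. -/
lemma mem_carrier_joinVerts {p : Fin (2 * n + 4) → ℝ} :
    p ∈ TetComplex.carrier (joinVerts n) ↔ IsJoinPoint (upperWeights p) (lowerWeights p) := by
  constructor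
  · rintro ⟨⟨h0, h1⟩, ⟨i, hi⟩, h⟩
    refine ⟨fun _ => h0 _, fun _ => h0 _, by rw [← sum_eq_total_add, h1], ?_⟩
    have hz : ∀ w (hw : w < 2 * n + 4), ¬ IsJoinVertex n i w → p ⟨w, hw⟩ = 0 := fun w hw hv =>
      h _ fun hm => hv (mem_joinVerts.1 hm)
    have hs : i ≤ n + 1 → OnEnds (upperWeights p) := by
      intro hi j h0 hl
      refine hz _ _ ?_
      have : (j : ℕ) ≠ 0 := fun h => h0 (Fin.ext h)
      have : (j : ℕ) ≠ n + 1 := fun h => hl (Fin.ext h)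
      simp only [IsJoinVertex]
      omega
    have ht : n + 1 ≤ i → OnEnds (lowerWeights p) := by
      intro hi j h0 hl
      refine hz _ _ ?_
      have : (j : ℕ) ≠ 0 := fun h => h0 (Fin.ext h)
      have : (j : ℕ) ≠ n + 1 := fun h => hl (Fin.ext h)
      simp only [IsJoinVertex]
      omega
    by_cases h1 : i ≤ n
    · refine Or.inr (Or.inr ⟨hs (by omega), ⟨i, by omega⟩, fun j hj hj' => hz _ _ ?_⟩)
      rw [ne_eq, Fin.ext_iff] at hj hj'
      simp only [IsJoinVertex, Fin.val_castSucc, Fin.val_succ] at *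
      omega
    by_cases h2 : i = n + 1
    · exact Or.inr (Or.inl ⟨hs (by omega), ht (by omega)⟩)
    · refine Or.inl ⟨⟨⟨i - (n + 2), by omega⟩, fun j hj hj' => hz _ _ ?_⟩, ht (by omega)⟩
      rw [ne_eq, Fin.ext_iff] at hj hj'
      simp only [IsJoinVertex, Fin.val_castSucc, Fin.val_succ] at *
      omega
  · rintro ⟨hs, ht, h1, hc⟩
    have hw : ∀ P : ℕ → Prop, (∀ j : Fin (n + 2), ¬ P (n + 2 + j) → upperWeights p j = 0) →
        (∀ j : Fin (n + 2), ¬ P j → lowerWeights p j = 0) →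
        ∀ w : Fin (2 * n + 4), ¬ P w → p w = 0 := by
      rintro P h h' ⟨w, hw⟩ hP
      by_cases hlt : w < n + 2
      · exact h' ⟨w, hlt⟩ hP
      · have e : n + 2 + (w - (n + 2)) = w := by omega
        have := h ⟨w - (n + 2), by omega⟩ (by simpa only [e] using hP)
        simpa only [upperWeights, e] using this
    refine ⟨⟨fun w => ?_, by rw [sum_eq_total_add, h1]⟩, ?_⟩
    · obtain ⟨w, hw⟩ := w
      by_cases hlt : w < n + 2
      · exact ht ⟨w, hlt⟩
      · have e : n + 2 + (w - (n + 2)) = w := by omega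
        have := hs ⟨w - (n + 2), by omega⟩
        simpa only [upperWeights, e] using this
    · have hends : ∀ (σ : Fin (n + 2) → ℝ), OnEnds σ → ∀ j : Fin (n + 2),
          (j : ℕ) ≠ 0 → (j : ℕ) ≠ n + 1 → σ j = 0 := fun σ h j h0 hl =>
        h j (fun h => h0 (congrArg Fin.val h)) (fun h => hl (congrArg Fin.val h))
      have hpath : ∀ (σ : Fin (n + 2) → ℝ), OnPath σ → ∃ i : ℕ, i ≤ n ∧ ∀ j : Fin (n + 2),
          (j : ℕ) ≠ i → (j : ℕ) ≠ i + 1 → σ j = 0 := fun σ ⟨i, hi⟩ => ⟨i, by omega,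
        fun j h0 hl => hi j (fun h => h0 (congrArg Fin.val h)) (fun h => hl (congrArg Fin.val h))⟩
      rcases hc with ⟨a, b⟩ | ⟨a, b⟩ | ⟨a, b⟩
      · obtain ⟨i, hi, a⟩ := hpath _ a
        refine ⟨⟨n + 2 + i, by omega⟩, fun w => ?_⟩
        rw [mem_joinVerts]
        refine hw (IsJoinVertex n (n + 2 + i)) (fun j hj => a _ ?_ ?_) (fun j hj => hends _ b _ ?_ ?_) w <;>
          unfold IsJoinVertex at hj <;> omega
      · refine ⟨⟨n + 1, by omega⟩, fun w => ?_⟩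
        rw [mem_joinVerts]
        refine hw (IsJoinVertex n (n + 1)) (fun j hj => hends _ a _ ?_ ?_) (fun j hj => hends _ b _ ?_ ?_) w <;>
          unfold IsJoinVertex at hj <;> omega
      · obtain ⟨i, hi, b⟩ := hpath _ b
        refine ⟨⟨i, by omega⟩, fun w => ?_⟩
        rw [mem_joinVerts]
        refine hw (IsJoinVertex n (i)) (fun j hj => hends _ a _ ?_ ?_) (fun j hj => b _ ?_ ?_) w <;>
          unfold IsJoinVertex at hj <;> omega

/-- The piecewise linear map that embeds the decomposition in space. -/
noncomputable def joinMap (p : Fin (2 * n + 4) → ℝ) : EuclideanSpace ℝ (Fin 3) :=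
  !₂[moment (upperWeights p), moment (lowerWeights p),
    height (upperWeights p) - height (lowerWeights p)]

lemma continuous_joinMap : Continuous (joinMap (n := n)) := by
  unfold joinMap height moment total minEnds upperWeights lowerWeights
  refine (PiLp.continuous_toLp 2 _).comp (continuous_pi fun i => ?_)
  fin_cases i <;> simp <;> fun_prop

lemma joinComplex_isBall (hn : 2 ≤ n) : (joinComplex hn).IsBall := by
  refine TetComplex.ofVerts_isBall continuous_joinMap ?_ ?_ convex_wedgeBody
    interior_wedgeBody_nonempty isBounded_wedgeBody
  · intro p hp q hq h
    have h0 := congrArg (· 0) h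
    have h1 := congrArg (· 1) h
    have h2 := congrArg (· 2) h
    simp [joinMap] at h0 h1 h2
    obtain ⟨hs, ht⟩ := (mem_carrier_joinVerts.1 hp).ext (by omega) (mem_carrier_joinVerts.1 hq)
      h0 h1 h2
    exact eq_of_weights_eq hs ht
  · ext P
    constructor
    · rintro ⟨p, hp, rfl⟩
      simpa [wedgeBody, joinMap] using (mem_carrier_joinVerts.1 hp).height_bounds (by omega)
    · rintro ⟨h₁, h₂⟩
      obtain ⟨s, t, hst, hx, hy, hz⟩ := exists_isJoinPoint (n := n) (by omega) h₁ h₂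
      refine ⟨joinWeights s t, mem_carrier_joinVerts.2 ?_, ?_⟩
      · rwa [upperWeights_joinWeights, lowerWeights_joinWeights]
      · rw [joinMap, upperWeights_joinWeights, lowerWeights_joinWeights, hx, hy, hz]
        ext i
        fin_cases i <;> simp

end Decomposition

theorem lemma3p5 (n : ℕ) (hn : 2 ≤ n) :
    tet (sphereTriangulation (SigmaPolygon.Tplus n) (SigmaPolygon.Tminus n)) = 2 * n + 3 := by
  have hmem : HasTetDecomposition (tau n) (2 * n + 3) :=
    ⟨2 * n + 4, joinComplex hn, Function.Embedding.refl _, joinComplex_isBall hn,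
      joinComplex_hasBoundary hn⟩
  -- The explicit decomposition also shows that the infimum is over a nonempty set, so it is not the
  -- default value 0.
  refine le_antisymm (Nat.sInf_le hmem) (le_csInf ⟨_, hmem⟩ ?_)
  rintro m ⟨k, K, e, -, hK⟩
  exact K.le_of_hasBoundary hn hK
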